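/- **Setting.** Let $W_{YZ|X}$ be a discrete memoryless broadcast channel with input alphabet $\{0,1\}$ and finite output alphabets $\mathcal Y$ (Bob) and $\mathcal Z$ (Willie). Write $P_a=W_{Y|X}(\cdot|a)$ and $Q_a=W_{Z|X}(\cdot|a)$. Assume that $P_0,P_1$ are mutually absolutely continuous, that $Q_0,Q_1$ are mutually absolutely continuous and distinct, that Willie's channel $W_{Z|X}$ has a unique capacity-achieving input distribution $\Lambda$ with $\lambda^*=\Lambda(1)>0$, and that $I(\Lambda,W_{Y|X})\ge I(\Lambda,W_{Z|X})$. Logarithms are natural, $D(P\|Q)=\sum P\log\frac PQ$ and $\chi^2(P\|Q)=\sum\frac{(P-Q)^2}{Q}$. A code of block length $n$ has codewords $\mathbf x_{ij}\in\{0,1\}^n$ for $0\le i\le M_1$, $1\le j\le M_2$, where $M_1,M_2\ge 1$. The common message $W_2$ is uniform on $\{1,\dots,M_2\}$. The covert message is either absent ($W_1=0$) or uniform on $\{1,\dots,M_1\}$ ($W_1\ne 0$). Bob forms estimates $\hat W_1,\hat W_2$ from $\mathbf Y$ and Willie forms an estimate $\tilde W_2$ from $\mathbf Z$. Put $$P^{(1)}_{e,1,j}=\mathbb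 P(\hat W_2\ne j\mid W_1=0,W_2=j)+\mathbb P(\hat W_2\ne j\mid W_1\ne0,W_2=j),$$ $$P^{(1)}_{e,2,j}=\mathbb P(\hat W_1\ne 0\mid W_1=0,\hat W_2=W_2=j)+\mathbb P(\hat W_1\ne W_1\mid W_1\ne0,\hat W_2=W_2=j),$$ $$P^{(2)}_{e,j}=\mathbb P(\tilde W_2\ne j\mid W_1=0,W_2=j)+\mathbb P(\tilde W_2\ne j\mid W_1\ne0,W_2=j),$$ $$P_e^{(1)}=\frac1{M_2}\sum_{j}\bigl(P^{(1)}_{e,1,j}+P^{(1)}_{e,2,j}\bigr),\qquad P_e^{(2)}=\frac1{M_2}\sum_{j}P^{(2)}_{e,j},$$ $$\bar Q^n_j=W^{\otimes n}_{Z|X}(\cdot|\mathbf x_{0j}),\qquad \hat Q^n_j=\frac1{M_1}\sum_{i=1}^{M_1}W^{\otimes n}_{Z|X}(\cdot|\mathbf x_{ij}).$$ **Theorem 2 (converse).** The function $$f(\gamma)=\sqrt2\,\frac{(1-\lambda^*)D(P_1\|P_0)+\lambda^*\gamma D(P_0\|P_1)}{\sqrt{(1-\lambda^*)\chi^2(Q_1\|Q_0)+\lambda^*\gamma^2\chi^2(Q_0\|Q_1)}}$$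 attains its maximum over $\gamma\ge0$; let $\gamma^*\ge0$ be any maximizer. Consider a sequence of codes with strictly increasing block lengths $n$ such that - $P_e^{(1)}\to0$ and $P_e^{(2)}\to0$, - $D(\hat Q^n_j\|\bar Q^n_j)\to0$ for every choice of common messages $j=j_n\in\{1,\dots,M_2\}$, and - the common message is sent at the capacity of Willie's channel, i.e. $\frac{\log M_2}{n}\to I(\Lambda,W_{Z|X})$. Call a choice of common messages $j=j_n$ *reliable and typical* if $P^{(1)}_{e,1,j}\to0$, $P^{(1)}_{e,2,j}\to0$, and the fraction of ones in the innocent codeword $\mathbf x_{0j}$ tends to $\lambda^*$. Then: 1. There are sets $G_n\subseteq\{1,\dots,M_2\}$ with $|G_n|/M_2\to1$ such that every choice $j=j_n$ with $j_n\in G_n$ for all sufficiently large $n$ is reliable and typical. 2. For every reliable and typical choice $j=j_n$ (hence for all but a vanishing fraction of the common messages), $D(\hat Q^n_j\|\bar Q^n_j)>0$ for all large $n$ and $$\limsup_{n\to\infty}\frac{\log M_1}{\sqrt{n\,D(\hat Q^n_j\|\bar Q^n_j)}}\le\max_{\gamma\ge0}f(\gamma)=f(\gamma^*).$$ 3. If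 for such a choice $\lim_{n\to\infty}\frac{\log M_1}{\sqrt{nD(\hat Q^n_j\|\bar Q^n_j)}}=f(\gamma^*)$, i.e. the bound holds with equality, then $$\liminf_{n\to\infty}\frac{\log M_1}{\sqrt{n\,D(\hat Q^n_j\|\bar Q^n_j)}}\ge\sqrt2\,\frac{(1-\lambda^*)D(Q_1\|Q_0)+\lambda^*\gamma^*D(Q_0\|Q_1)}{\sqrt{(1-\lambda^*)\chi^2(Q_1\|Q_0)+\lambda^*(\gamma^*)^2\chi^2(Q_0\|Q_1)}}.$$ -/

import Mathlib

open Filter Topology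

namespace CovertBroadcast

noncomputable section

/-! ### Finite-alphabet information measures -/

/-- Kullback-Leibler divergence `D(P‖Q) = ∑ P log (P / Q)` in nats, for finite alphabets
(used only for `P ≪ Q`). -/
def kl {B : Type*} [Fintype B] (P Q : B → ℝ) : ℝ :=
  ∑ b, P b * Real.log (P b / Q b)

/-- Chi-squared distance `χ²(P‖Q) = ∑ (P - Q)² / Q`. -/
def chiSq {B : Type*} [Fintype B] (P Q : B → ℝ) : ℝ :=
  ∑ b, (P b - Q b) ^ 2 / Q b

/-- Mutual information `I(p, V)` for an input law `p` on `{0,1}` and a channel `V`. -/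
def mutualInfo {B : Type*} [Fintype B] (p : Fin 2 → ℝ) (V : Fin 2 → B → ℝ) : ℝ :=
  ∑ x, p x * kl (V x) (fun b => ∑ x', p x' * V x' b)

/-- `Λ` is an input law on `{0,1}` that attains the capacity of `V`. -/
def AchievesCapacity {B : Type*} [Fintype B] (V : Fin 2 → B → ℝ) (Λ : Fin 2 → ℝ) : Prop :=
  Λ ∈ stdSimplex ℝ (Fin 2) ∧
    ∀ p ∈ stdSimplex ℝ (Fin 2), mutualInfo p V ≤ mutualInfo Λ V

/-! ### The channel model -/

/-- A binary-input discrete memoryless broadcast channel `W_{YZ|X}` with finite outputs. -/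
structure BroadcastChannel (Y Z : Type*) [Fintype Y] [Fintype Z] where
  W : Fin 2 → Y × Z → ℝ
  nonneg : ∀ x yz, 0 ≤ W x yz
  sum_one : ∀ x, ∑ yz, W x yz = 1

/-- Bob's marginal channel; `ch.bob a` is `P_a`. -/
def BroadcastChannel.bob {Y Z : Type*} [Fintype Y] [Fintype Z]
    (ch : BroadcastChannel Y Z) (x : Fin 2) (y : Y) : ℝ :=
  ∑ z, ch.W x (y, z)

/-- Willie's marginal channel; `ch.willie a` is `Q_a`. -/
def BroadcastChannel.willie {Y Z : Type*} [Fintype Y] [Fintype Z]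
    (ch : BroadcastChannel Y Z) (x : Fin 2) (z : Z) : ℝ :=
  ∑ y, ch.W x (y, z)

/-- The standing assumptions on the channel; `Λ` is Willie's capacity-achieving input law and
`Λ 1` is the number `λ*`. -/
structure BroadcastChannel.Standing {Y Z : Type*} [Fintype Y] [Fintype Z]
    (ch : BroadcastChannel Y Z) (Λ : Fin 2 → ℝ) : Prop where
  bob_ac : ∀ a b : Fin 2, a ≠ b → ∀ y, ch.bob b y = 0 → ch.bob a y = 0
  willie_ac : ∀ a b : Fin 2, a ≠ b → ∀ z, ch.willie b z = 0 → ch.willie a z = 0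
  willie_ne : ch.willie 0 ≠ ch.willie 1
  capacity : AchievesCapacity ch.willie Λ
  capacity_unique : ∀ p, AchievesCapacity ch.willie p → p = Λ
  pos : 0 < Λ 1
  bob_ge : mutualInfo Λ ch.willie ≤ mutualInfo Λ ch.bob

/-- The `n`-fold memoryless channel. -/
def nfold {B : Type*} (V : Fin 2 → B → ℝ) {n : ℕ} (x : Fin n → Fin 2) (b : Fin n → B) : ℝ :=
  ∏ l, V (x l) (b l)

open Classical in
/-- Probability that the output lies in `E` when `x` is sent over the `n`-fold channel. -/
def outProb {B : Type*} [Fintype B] (V : Fin 2 → B → ℝ) {n : ℕ} (x : Fin n → Fin 2)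
    (E : Set (Fin n → B)) : ℝ :=
  ∑ b, if b ∈ E then nfold V x b else 0

/-! ### Codes -/

/-- A code of block length `n` with `M₁` covert and `M₂` common messages.  `enc i j` is the
codeword `x_{ij}`; the index `i = 0` means that there is no covert message and the indices
`1, …, M₁` (the values `i.succ` for `i : Fin M₁`) are the covert messages.  Bob estimates both
messages, Willie the common one; the estimate `none` is a declared decoding failure. -/
structure Code (Y Z : Type*) (n M₁ M₂ : ℕ) where
  enc : Fin (M₁ + 1) → Fin M₂ → Fin n → Fin 2
  decBob₁ : (Fin n → Y) → Option (Fin (M₁ + 1))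
  decBob₂ : (Fin n → Y) → Option (Fin M₂)
  decWillie : (Fin n → Z) → Option (Fin M₂)

namespace Code

variable {Y Z : Type*} [Fintype Y] [Fintype Z] {n M₁ M₂ : ℕ}

/-- Willie's output law given `W₂ = j` and no covert message. -/
def innocentLaw (C : Code Y Z n M₁ M₂) (ch : BroadcastChannel Y Z) (j : Fin M₂)
    (z : Fin n → Z) : ℝ :=
  nfold ch.willie (C.enc 0 j) z

/-- Willie's output law given `W₂ = j` and a uniformly distributed covert message. -/
def covertLaw (C : Code Y Z n M₁ M₂) (ch : BroadcastChannel Y Z) (j : Fin M₂)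
    (z : Fin n → Z) : ℝ :=
  (∑ i : Fin M₁, nfold ch.willie (C.enc i.succ j) z) / M₁

/-- The covertness metric `D(Q̂ⁿ_j‖Q̄ⁿ_j)`. -/
def divergence (C : Code Y Z n M₁ M₂) (ch : BroadcastChannel Y Z) (j : Fin M₂) : ℝ :=
  kl (C.covertLaw ch j) (C.innocentLaw ch j)

/-- Willie's error metric for `W₂ = j`:
`P(W̃₂ ≠ j | W₁ = 0, W₂ = j) + P(W̃₂ ≠ j | W₁ ≠ 0, W₂ = j)`. -/
def errWillie (C : Code Y Z n M₁ M₂) (ch : BroadcastChannel Y Z) (j : Fin M₂) : ℝ :=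
  outProb ch.willie (C.enc 0 j) {z | C.decWillie z ≠ some j} +
    (∑ i : Fin M₁, outProb ch.willie (C.enc i.succ j) {z | C.decWillie z ≠ some j}) / M₁

/-- Bob's error metric on the common message for `W₂ = j`:
`P(Ŵ₂ ≠ j | W₁ = 0, W₂ = j) + P(Ŵ₂ ≠ j | W₁ ≠ 0, W₂ = j)`. -/
def errBobCommon (C : Code Y Z n M₁ M₂) (ch : BroadcastChannel Y Z) (j : Fin M₂) : ℝ :=
  outProb ch.bob (C.enc 0 j) {y | C.decBob₂ y ≠ some j} +
    (∑ i : Fin M₁, outProb ch.bob (C.enc i.succ j) {y | C.decBob₂ y ≠ some j}) / M₁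

/-- Bob's error metric on the covert message for `W₂ = j`:
`P(Ŵ₁ ≠ 0 | W₁ = 0, Ŵ₂ = W₂ = j) + P(Ŵ₁ ≠ W₁ | W₁ ≠ 0, Ŵ₂ = W₂ = j)`.
(A conditional probability given a null event is read as `0`; if the conditioning event is null
then `errBobCommon` is at least `1`.) -/
def errBobCovert (C : Code Y Z n M₁ M₂) (ch : BroadcastChannel Y Z) (j : Fin M₂) : ℝ :=
  outProb ch.bob (C.enc 0 j) {y | C.decBob₁ y ≠ some 0 ∧ C.decBob₂ y = some j} /
      outProb ch.bob (C.enc 0 j) {y | C.decBob₂ y = some j} +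
    (∑ i : Fin M₁,
        outProb ch.bob (C.enc i.succ j) {y | C.decBob₁ y ≠ some i.succ ∧ C.decBob₂ y = some j}) /
      (∑ i : Fin M₁, outProb ch.bob (C.enc i.succ j) {y | C.decBob₂ y = some j})

/-- Bob's overall metric `P_e^{(1)}`, averaged over the common message. -/
def bobError (C : Code Y Z n M₁ M₂) (ch : BroadcastChannel Y Z) : ℝ :=
  (∑ j, (C.errBobCommon ch j + C.errBobCovert ch j)) / M₂

/-- Willie's overall metric `P_e^{(2)}`, averaged over the common message. -/
def willieError (C : Code Y Z n M₁ M₂) (ch : BroadcastChannel Y Z) : ℝ :=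
  (∑ j, C.errWillie ch j) / M₂

/-- Fraction of ones in the innocent codeword of the common message `j`. -/
def weightFraction (C : Code Y Z n M₁ M₂) (j : Fin M₂) : ℝ :=
  ((Finset.univ.filter fun l => C.enc 0 j l = 1).card : ℝ) / n

/-- The normalized number of covert nats `log M₁ / √(n D(Q̂ⁿ_j‖Q̄ⁿ_j))`. -/
def throughput (C : Code Y Z n M₁ M₂) (ch : BroadcastChannel Y Z) (j : Fin M₂) : ℝ :=
  Real.log M₁ / √(n * C.divergence ch j)

end Code

/-- The `√2`-ratio at `γ`, with the divergences of the channel `V` (Bob's or Willie's) in the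
numerator and Willie's chi-squared distances in the denominator. -/
def ratio {Y Z B : Type*} [Fintype Y] [Fintype Z] [Fintype B] (ch : BroadcastChannel Y Z)
    (V : Fin 2 → B → ℝ) (lam γ : ℝ) : ℝ :=
  √2 * ((1 - lam) * kl (V 1) (V 0) + lam * γ * kl (V 0) (V 1)) /
    √((1 - lam) * chiSq (ch.willie 1) (ch.willie 0) +
      lam * γ ^ 2 * chiSq (ch.willie 0) (ch.willie 1))

/-- Along the sequence of codes `C k`, the sequence of common messages `j k` is decoded reliably
by Bob, together with the covert message, and its innocent codewords have asymptotically the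
fraction `lam` of ones. -/
def ReliableTypical {Y Z : Type*} [Fintype Y] [Fintype Z] (ch : BroadcastChannel Y Z) (lam : ℝ)
    {n M₁ M₂ : ℕ → ℕ} (C : ∀ k, Code Y Z (n k) (M₁ k) (M₂ k)) (j : ∀ k, Fin (M₂ k)) : Prop :=
  Tendsto (fun k => (C k).errBobCommon ch (j k)) atTop (𝓝 0) ∧
    Tendsto (fun k => (C k).errBobCovert ch (j k)) atTop (𝓝 0) ∧
    Tendsto (fun k => (C k).weightFraction (j k)) atTop (𝓝 lam)

end

end CovertBroadcast

/-! Fix a common message and let α_l be the fraction of covert codewords that differ from the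
innocent codeword at position l. Everything is expressed through the flip masses A₀, A₁, the sums of
α_l over the zeros and over the ones of the innocent codeword.

Reliability: A₀ D(P₁‖P₀) + A₁ D(P₀‖P₁) is the average divergence at Bob of a covert codeword from
the innocent one. The covert decoding regions are disjoint and together improbable under the
innocent codeword, so this average is at least about log M₁ (`Code.log_le_mass_bob`).

Covertness: δ = D(Q̂‖Q̄) is at least the sum of the single-letter divergences of the marginals, each
about α_l² χ²/2. By Cauchy-Schwarz, with a fraction of ones near λ*, the normalized masses u =
A₀/√(nδ) and v = A₁/√(nδ) lie asymptotically in an ellipse (`exists_mass_sq_le`).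

The bound is thus the maximum of a linear functional over an ellipse. The maximizer is unique, and
the squared distance to it is controlled by the shortfall of the throughput (`quadratic_centred`).
Equality therefore forces (u, v) to converge to it. A code with M₁ words carries mutual information
at most log M₁ to Willie, so A₀ D(Q₁‖Q₀) + A₁ D(Q₀‖Q₁) ≤ log M₁ + δ (`Code.mass_willie_le`), and the
limit gives the last claim.

Typical weights come from a converse at Willie: innocent codewords of atypical weight support only
rates strictly below capacity, by uniqueness of Λ (`Code.farFraction_mul_le`). Markov's inequality
then selects the good messages. -/

namespace CovertBroadcast

/-! ### Divergence inequalities -/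

section Divergence

variable {B : Type*} [Fintype B]

/-- A pointwise form of the Donsker-Varadhan variational bound. -/
theorem kl_ge {P Q : B → ℝ} (g : B → ℝ) (hP : ∀ b, 0 ≤ P b) (hQ : ∀ b, 0 ≤ Q b)
    (hac : ∀ b, Q b = 0 → P b = 0) :
    ∑ b, P b * g b + ∑ b, P b - ∑ b, Q b * Real.exp (g b) ≤ kl P Q := by
  rw [kl, ← Finset.sum_add_distrib, ← Finset.sum_sub_distrib]
  refine Finset.sum_le_sum fun b _ => ?_
  rcases (hP b).eq_or_lt with h | h
  · rw [← h]
    have := mul_nonneg (hQ b) (Real.exp_pos (g b)).le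
    simpa using this
  · have hq : 0 < Q b := (hQ b).lt_of_ne fun h0 => h.ne' (hac b h0.symm)
    have h1 := Real.log_le_sub_one_of_pos (show 0 < Q b * Real.exp (g b) / P b by positivity)
    rw [Real.log_div (by positivity) h.ne', Real.log_mul hq.ne' (Real.exp_pos _).ne',
      Real.log_exp] at h1
    rw [Real.log_div h.ne' hq.ne']
    have h2 := mul_le_mul_of_nonneg_left h1 h.le
    have h3 : P b * (Q b * Real.exp (g b) / P b - 1) = Q b * Real.exp (g b) - P b := by
      field_simp
    linarith

theorem kl_self (P : B → ℝ) : kl P P = 0 := by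
  refine Finset.sum_eq_zero fun b _ => ?_
  by_cases h : P b = 0 <;> simp [h]

theorem kl_nonneg {P Q : B → ℝ} (hP : P ∈ stdSimplex ℝ B) (hQ : Q ∈ stdSimplex ℝ B)
    (hac : ∀ b, Q b = 0 → P b = 0) : 0 ≤ kl P Q := by
  simpa [hP.2, hQ.2] using kl_ge (fun _ => 0) hP.1 hQ.1 hac

-- The variational bound with test function `t` on `E` and 0 elsewhere. Leaving `t` free gives a
-- hypothesis-testing converse; both decoding converses below choose it so that `exp t` balances the
-- mass of the decoding events under the reference law.
open Classical in
theorem kl_ge_event {P Q : B → ℝ} (hP : P ∈ stdSimplex ℝ B) (hQ : Q ∈ stdSimplex ℝ B)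
    (hac : ∀ b, Q b = 0 → P b = 0) (E : Set B) (t : ℝ) :
    t * (∑ b, if b ∈ E then P b else 0) - Real.exp t * (∑ b, if b ∈ E then Q b else 0)
      ≤ kl P Q := by
  refine le_trans ?_ (kl_ge (fun b => if b ∈ E then t else 0) hP.1 hQ.1 hac)
  have h1 : ∑ b, P b * (if b ∈ E then t else 0) = t * (∑ b, if b ∈ E then P b else 0) := by
    rw [Finset.mul_sum]
    refine Finset.sum_congr rfl fun b _ => ?_
    split_ifs <;> ring
  have h2 : ∑ b, Q b * Real.exp (if b ∈ E then t else 0)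
      ≤ Real.exp t * (∑ b, if b ∈ E then Q b else 0) + ∑ b, Q b := by
    rw [Finset.mul_sum, ← Finset.sum_add_distrib]
    refine Finset.sum_le_sum fun b _ => ?_
    have := hQ.1 b
    split_ifs <;> simp
    · linarith [mul_comm (Q b) (Real.exp t)]
  rw [h1]
  have h3 := hP.2
  have h4 := hQ.2
  linarith

/-- A global substitute for the Taylor expansion u + u²/2 that keeps the sharp constant 1/2 as u →
0. For u ≥ 0 it is log(1+u) ≥ 2u/(2+u); for u < 0 it follows from y ≤ sinh y at y = -log(1+u). -/
theorem add_sq_div_le_mul_log {u : ℝ} (hu : -1 ≤ u) :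
    u + u ^ 2 / (2 + |u|) ≤ (1 + u) * Real.log (1 + u) := by
  rcases le_or_gt 0 u with h | h
  · have h1 := Real.le_log_one_add_of_nonneg h
    have h2 := mul_le_mul_of_nonneg_left h1 (show 0 ≤ 1 + u by linarith)
    refine le_trans (le_of_eq ?_) h2
    rw [abs_of_nonneg h]
    have : u + 2 ≠ 0 := by positivity
    have : 2 + u ≠ 0 := by positivity
    field_simp
    ring
  · have h0 : u + u ^ 2 / (2 + |u|) ≤ u + u ^ 2 / 2 := by
      gcongr
      linarith [abs_nonneg u]
    refine h0.trans ?_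
    rcases hu.eq_or_lt with h1 | h1
    · rw [← h1]; norm_num
    · have hx : 0 < 1 + u := by linarith
      have h2 : -Real.log (1 + u) ≤ Real.sinh (-Real.log (1 + u)) :=
        Real.self_le_sinh_iff.2 (neg_nonneg.2 (Real.log_nonpos hx.le (by linarith)))
      rw [Real.sinh_neg, Real.sinh_log hx] at h2
      have h3 : ((1 + u) - (1 + u)⁻¹) / 2 ≤ Real.log (1 + u) := by linarith
      refine le_trans (le_of_eq ?_) (mul_le_mul_of_nonneg_left h3 hx.le)
      field_simp
      ring

/-- The preceding bound at the relative perturbation u = a(P/Q - 1), whose linear term sums to zero.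
Every larger `R'` is admitted so that one constant can serve both letters. -/
theorem exists_le_kl_mix {P Q : B → ℝ} (hP : P ∈ stdSimplex ℝ B) (hQ : Q ∈ stdSimplex ℝ B)
    (hac : ∀ b, Q b = 0 → P b = 0) :
    ∃ R : ℝ, 0 ≤ R ∧ ∀ R', R ≤ R' → ∀ a ∈ Set.Icc (0 : ℝ) 1,
      a ^ 2 * chiSq P Q / (2 + a * R') ≤ kl (fun b => (1 - a) * Q b + a * P b) Q := by
  refine ⟨∑ b, |P b / Q b - 1|, by positivity, fun R' hR' a ha => ?_⟩
  have hR0 : 0 ≤ R' := le_trans (by positivity) hR'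
  have key : ∀ b, a * (P b - Q b) + a ^ 2 * ((P b - Q b) ^ 2 / Q b) / (2 + a * R')
      ≤ ((1 - a) * Q b + a * P b) * Real.log (((1 - a) * Q b + a * P b) / Q b) := by
    intro b
    rcases (hQ.1 b).eq_or_lt with h | h
    · simp [← h, hac b h.symm]
    · set u := a * (P b / Q b - 1) with hu
      have e1 : ((1 - a) * Q b + a * P b) / Q b = 1 + u := by rw [hu]; field_simp; ring
      have e2 : (1 - a) * Q b + a * P b = Q b * (1 + u) := by rw [hu]; field_simp; ring
      have hu1 : -1 ≤ u := by
        have : 0 ≤ P b / Q b := div_nonneg (hP.1 b) h.le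
        rw [hu]; nlinarith [ha.1, ha.2, mul_nonneg ha.1 this]
      have hur : |u| ≤ a * R' := by
        rw [hu, abs_mul, abs_of_nonneg ha.1]
        refine mul_le_mul_of_nonneg_left (le_trans ?_ hR') ha.1
        exact Finset.single_le_sum (f := fun b => |P b / Q b - 1|)
          (fun i _ => abs_nonneg _) (Finset.mem_univ b)
      rw [e1, e2, mul_assoc]
      have h1 : u + u ^ 2 / (2 + a * R') ≤ u + u ^ 2 / (2 + |u|) := by
        gcongr
      refine le_trans (le_of_eq ?_)
        (mul_le_mul_of_nonneg_left (h1.trans (add_sq_div_le_mul_log hu1)) h.le)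
      have : 2 + a * R' ≠ 0 := by have := mul_nonneg ha.1 hR0; positivity
      rw [hu]
      field_simp
  have hs : ∑ b, (a * (P b - Q b) + a ^ 2 * ((P b - Q b) ^ 2 / Q b) / (2 + a * R'))
      = a ^ 2 * chiSq P Q / (2 + a * R') := by
    rw [Finset.sum_add_distrib, ← Finset.mul_sum, Finset.sum_sub_distrib, hP.2, hQ.2,
      ← Finset.sum_div, ← Finset.mul_sum, chiSq]
    simp
  rw [← hs]
  exact Finset.sum_le_sum fun b _ => key b

theorem chiSq_pos {P Q : B → ℝ} (hQ : Q ∈ stdSimplex ℝ B)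
    (hac : ∀ b, Q b = 0 → P b = 0) (hne : P ≠ Q) : 0 < chiSq P Q := by
  obtain ⟨b, hb⟩ := Function.ne_iff.1 hne
  refine Finset.sum_pos' (fun b _ => div_nonneg (sq_nonneg _) (hQ.1 b)) ⟨b, Finset.mem_univ b, ?_⟩
  have hq : 0 < Q b := (hQ.1 b).lt_of_ne fun h0 => hb (by rw [← h0, hac b h0.symm])
  have := sub_ne_zero.2 hb
  positivity

theorem kl_pos {P Q : B → ℝ} (hP : P ∈ stdSimplex ℝ B) (hQ : Q ∈ stdSimplex ℝ B)
    (hac : ∀ b, Q b = 0 → P b = 0) (hne : P ≠ Q) : 0 < kl P Q := by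
  obtain ⟨R, hR, h⟩ := exists_le_kl_mix hP hQ hac
  have h1 := h R le_rfl 1 (by simp)
  have hc := chiSq_pos hQ hac hne
  refine lt_of_lt_of_le (by positivity) (h1.trans (le_of_eq ?_))
  simp

end Divergence

/-! ### Product laws -/

section Product

variable {B : Type*} [Fintype B] {n : ℕ}

theorem sum_prod_eq (F : Fin n → B → ℝ) : ∑ b : Fin n → B, ∏ l, F l (b l) = ∏ l, ∑ z, F l z := by
  classical
  rw [Finset.prod_univ_sum, Fintype.piFinset_univ]

theorem prod_mem_stdSimplex {P : Fin n → B → ℝ} (hP : ∀ l, P l ∈ stdSimplex ℝ B) :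
    (fun b : Fin n → B => ∏ l, P l (b l)) ∈ stdSimplex ℝ (Fin n → B) :=
  ⟨fun b => Finset.prod_nonneg fun l _ => (hP l).1 _, by
    rw [sum_prod_eq]; exact Finset.prod_eq_one fun l _ => (hP l).2⟩

theorem sum_prod_mul_apply {P : Fin n → B → ℝ} (hP : ∀ l, P l ∈ stdSimplex ℝ B) (l : Fin n)
    (g : B → ℝ) : ∑ b : Fin n → B, (∏ m, P m (b m)) * g (b l) = ∑ z, P l z * g z := by
  classical
  have h := sum_prod_eq fun m z => P m z * (if m = l then g z else 1)
  have h1 : ∀ b : Fin n → B, ∏ m, P m (b m) * (if m = l then g (b m) else 1)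
      = (∏ m, P m (b m)) * g (b l) := by
    intro b
    rw [Finset.prod_mul_distrib, Finset.prod_ite_eq' Finset.univ l fun m => g (b m)]
    simp
  simp only [h1] at h
  rw [h, Finset.prod_eq_single l]
  · simp
  · intro m _ hm
    simp [hm, (hP m).2]
  · simp

theorem prod_absCont {B : Type*} {P Q : Fin n → B → ℝ} (hac : ∀ l b, Q l b = 0 → P l b = 0) (b : Fin n → B)
    (h : ∏ l, Q l (b l) = 0) : ∏ l, P l (b l) = 0 := by
  obtain ⟨l, hl, h⟩ := Finset.prod_eq_zero_iff.1 h
  exact Finset.prod_eq_zero hl (hac l _ h)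

theorem kl_prod {P Q : Fin n → B → ℝ} (hP : ∀ l, P l ∈ stdSimplex ℝ B)
    (hac : ∀ l b, Q l b = 0 → P l b = 0) :
    kl (fun b : Fin n → B => ∏ l, P l (b l)) (fun b => ∏ l, Q l (b l))
      = ∑ l, kl (P l) (Q l) := by
  have h : ∀ b : Fin n → B, (∏ l, P l (b l)) * Real.log ((∏ l, P l (b l)) / ∏ l, Q l (b l))
      = ∑ l, (∏ m, P m (b m)) * Real.log (P l (b l) / Q l (b l)) := by
    intro b
    by_cases h0 : ∏ l, P l (b l) = 0
    · simp [h0]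
    · have hp : ∀ l, P l (b l) ≠ 0 := fun l => by
        simpa using (Finset.prod_ne_zero_iff.1 h0) l (Finset.mem_univ l)
      rw [← Finset.prod_div_distrib, Real.log_prod, Finset.mul_sum]
      exact fun l _ => div_ne_zero (hp l) fun h => hp l (hac l _ h)
  simp only [kl]
  simp only [h]
  rw [Finset.sum_comm]
  exact Finset.sum_congr rfl fun l _ =>
    sum_prod_mul_apply hP l fun z => Real.log (P l z / Q l z)

/-- Superadditivity of the divergence of a uniform mixture of product laws from a product law. -/
theorem sum_kl_le_kl_avg {M : ℕ} {P : Fin M → Fin n → B → ℝ} {Q : Fin n → B → ℝ}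
    (hM : 0 < M) (hP : ∀ i l, P i l ∈ stdSimplex ℝ B) (hQ : ∀ l, Q l ∈ stdSimplex ℝ B)
    (hac : ∀ i l b, Q l b = 0 ↔ P i l b = 0) :
    ∑ l, kl (fun z => (∑ i, P i l z) / M) (Q l)
      ≤ kl (fun b : Fin n → B => (∑ i, ∏ l, P i l (b l)) / M) (fun b => ∏ l, Q l (b l)) := by
  have hM' : (M : ℝ) ≠ 0 := by positivity
  have hm1 : ∀ l, ∑ z, (∑ i, P i l z) / M = 1 := by
    intro l
    rw [← Finset.sum_div, Finset.sum_comm]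
    simp [(hP _ l).2, hM']
  -- The test function is the log-likelihood ratio of the product of the mixture's marginals against
  -- `Q`, so tilting by it yields a law of mass 1.
  set g : (Fin n → B) → ℝ := fun b => ∑ l, Real.log ((∑ i, P i l (b l)) / M / Q l (b l)) with hg
  have h := kl_ge (P := fun b : Fin n → B => (∑ i, ∏ l, P i l (b l)) / M)
    (Q := fun b => ∏ l, Q l (b l)) g
    (fun b => div_nonneg (Finset.sum_nonneg fun i _ => Finset.prod_nonneg fun l _ => (hP i l).1 _)
      (Nat.cast_nonneg M))
    (fun b => Finset.prod_nonneg fun l _ => (hQ l).1 _)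
    (fun b hb => by
      rw [Finset.sum_eq_zero, zero_div]
      exact fun i _ => prod_absCont (fun l z => (hac i l z).1) b hb)
  have h1 : ∑ b : Fin n → B, (∑ i, ∏ l, P i l (b l)) / M = 1 := by
    rw [← Finset.sum_div, Finset.sum_comm]
    simp [fun i => (prod_mem_stdSimplex (hP i)).2, hM']
  have h2 : ∑ b : Fin n → B, (∏ l, Q l (b l)) * Real.exp (g b) = 1 := by
    have e : ∀ b : Fin n → B, (∏ l, Q l (b l)) * Real.exp (g b)
        = ∏ l, (∑ i, P i l (b l)) / M := by
      intro b
      rw [hg, Real.exp_sum, ← Finset.prod_mul_distrib]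
      refine Finset.prod_congr rfl fun l _ => ?_
      by_cases hz : Q l (b l) = 0
      · have : ∀ i, P i l (b l) = 0 := fun i => (hac i l _).1 hz
        simp [hz, this]
      · have hq : 0 < Q l (b l) := ((hQ l).1 _).lt_of_ne (Ne.symm hz)
        -- The reverse absolute continuity matters here: exp(log x) = x fails at x = 0.
        have hp : 0 < ∑ i, P i l (b l) :=
          Finset.sum_pos (fun i _ => ((hP i l).1 _).lt_of_ne
            fun h0 => hz ((hac i l _).2 h0.symm)) ⟨⟨0, hM⟩, Finset.mem_univ _⟩
        rw [Real.exp_log (by positivity)]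
        field_simp
    simp only [e]
    rw [sum_prod_eq fun l z => (∑ i, P i l z) / M]
    exact Finset.prod_eq_one fun l _ => hm1 l
  have h3 : ∑ b : Fin n → B, (∑ i, ∏ l, P i l (b l)) / M * g b
      = ∑ l, kl (fun z => (∑ i, P i l z) / M) (Q l) := by
    simp only [hg, kl, Finset.mul_sum]
    rw [Finset.sum_comm]
    refine Finset.sum_congr rfl fun l _ => ?_
    simp only [div_mul_eq_mul_div, Finset.sum_mul]
    rw [← Finset.sum_div, ← Finset.sum_div, Finset.sum_comm]
    conv_rhs => rw [Finset.sum_comm]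
    congr 1
    refine Finset.sum_congr rfl fun i _ => ?_
    exact sum_prod_mul_apply (hP i) l fun z => Real.log ((∑ i, P i l z) / M / Q l z)
  rw [h1, h2, h3] at h
  linarith

end Product

/-! ### Binary-input memoryless channels -/

section Memoryless

variable {B : Type*} [Fintype B] {V : Fin 2 → B → ℝ} {n M : ℕ}

theorem nfold_mem_stdSimplex (hV : ∀ a, V a ∈ stdSimplex ℝ B) (x : Fin n → Fin 2) :
    nfold V x ∈ stdSimplex ℝ (Fin n → B) :=
  prod_mem_stdSimplex fun l => hV (x l)

theorem nfold_absCont {B : Type*} {V : Fin 2 → B → ℝ} (hac : ∀ a b y, V b y = 0 → V a y = 0)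
    (x x' : Fin n → Fin 2) (y : Fin n → B) (h : nfold V x' y = 0) : nfold V x y = 0 :=
  prod_absCont (P := fun l => V (x l)) (Q := fun l => V (x' l)) (fun _ _ => hac _ _ _) y h

theorem outProb_nonneg (hV : ∀ a, V a ∈ stdSimplex ℝ B) (x : Fin n → Fin 2)
    (E : Set (Fin n → B)) : 0 ≤ outProb V x E :=
  Finset.sum_nonneg fun b _ => by
    have := (nfold_mem_stdSimplex hV x).1 b
    split_ifs <;> simp [this]

theorem outProb_mono (hV : ∀ a, V a ∈ stdSimplex ℝ B) (x : Fin n → Fin 2)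
    {E F : Set (Fin n → B)} (h : E ⊆ F) : outProb V x E ≤ outProb V x F :=
  Finset.sum_le_sum fun b _ => by
    have := (nfold_mem_stdSimplex hV x).1 b
    by_cases hE : b ∈ E
    · simp [hE, h hE]
    · by_cases hF : b ∈ F <;> simp [hE, hF, this]

theorem outProb_add_compl (hV : ∀ a, V a ∈ stdSimplex ℝ B) (x : Fin n → Fin 2)
    (E : Set (Fin n → B)) : outProb V x E + outProb V x Eᶜ = 1 := by
  rw [← (nfold_mem_stdSimplex hV x).2, outProb, outProb, ← Finset.sum_add_distrib]
  refine Finset.sum_congr rfl fun b _ => ?_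
  by_cases hE : b ∈ E <;> simp [hE]

theorem outProb_le_one (hV : ∀ a, V a ∈ stdSimplex ℝ B) (x : Fin n → Fin 2)
    (E : Set (Fin n → B)) : outProb V x E ≤ 1 := by
  linarith [outProb_add_compl hV x E, outProb_nonneg hV x Eᶜ]

theorem outProb_inter_add_diff (x : Fin n → Fin 2) (E F : Set (Fin n → B)) :
    outProb V x (E ∩ F) + outProb V x (Eᶜ ∩ F) = outProb V x F := by
  rw [outProb, outProb, ← Finset.sum_add_distrib]
  refine Finset.sum_congr rfl fun b _ => ?_
  by_cases hE : b ∈ E <;> by_cases hF : b ∈ F <;> simp [hE, hF]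

open Classical in
/-- Pairwise disjoint events have total mass at most that of any event containing them. -/
theorem sum_events_le {ι A : Type*} [Fintype ι] [Fintype A] {P : A → ℝ} (hP : ∀ b, 0 ≤ P b)
    (E : ι → Set A) (F : Set A) (hsub : ∀ i, E i ⊆ F)
    (hdis : ∀ i i' b, b ∈ E i → b ∈ E i' → i = i') :
    ∑ i, (∑ b, if b ∈ E i then P b else 0) ≤ ∑ b, if b ∈ F then P b else 0 := by
  rw [Finset.sum_comm]
  refine Finset.sum_le_sum fun b _ => ?_
  by_cases hb : ∃ i, b ∈ E i
  · obtain ⟨i, hi⟩ := hb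
    rw [Finset.sum_eq_single i, if_pos hi, if_pos (hsub i hi)]
    · exact fun i' _ hne => if_neg fun h => hne (hdis _ _ _ h hi)
    · simp
  · have : ∀ i, b ∉ E i := fun i hi => hb ⟨i, hi⟩
    simp only [this, if_false, Finset.sum_const_zero]
    split_ifs <;> simp [hP b]

/-- The fraction of the words `x i` that differ from `x0` at position `l`. -/
noncomputable def flipFrac (x0 : Fin n → Fin 2) (x : Fin M → Fin n → Fin 2) (l : Fin n) : ℝ :=
  ((Finset.univ.filter fun i => x i l ≠ x0 l).card : ℝ) / M

/-- The total flip fraction over the positions where `x0` has the letter `a`. -/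
noncomputable def flipMass (x0 : Fin n → Fin 2) (x : Fin M → Fin n → Fin 2) (a : Fin 2) : ℝ :=
  ∑ l with x0 l = a, flipFrac x0 x l

theorem flipFrac_nonneg (x0 : Fin n → Fin 2) (x : Fin M → Fin n → Fin 2) (l : Fin n) :
    0 ≤ flipFrac x0 x l := by
  unfold flipFrac; positivity

theorem flipFrac_le_one (x0 : Fin n → Fin 2) (x : Fin M → Fin n → Fin 2) (l : Fin n) :
    flipFrac x0 x l ≤ 1 := by
  refine div_le_one_of_le₀ ?_ (Nat.cast_nonneg M)
  exact_mod_cast (Finset.card_le_univ _).trans (by simp)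

theorem fin_two_eq (a : Fin 2) : a = 0 ∨ a = 1 := by
  revert a; decide

theorem eq_one_sub_of_ne {a b : Fin 2} (h : a ≠ b) : a = 1 - b := by
  revert a b; decide

theorem sum_fin_two_split (x0 : Fin n → Fin 2) (f : Fin n → ℝ) :
    ∑ l, f l = ∑ l with x0 l = 0, f l + ∑ l with x0 l = 1, f l := by
  rw [← Finset.sum_filter_add_sum_filter_not Finset.univ fun l => x0 l = 0]
  congr 2
  ext l
  simp only [Finset.mem_filter, Finset.mem_univ, true_and]
  generalize x0 l = a
  revert a; decide

/-- Divergence adds over positions and vanishes where the words agree; exchanging the two sums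
leaves the flip fractions. -/
theorem avg_kl_nfold (hV : ∀ a, V a ∈ stdSimplex ℝ B) (hac : ∀ a b y, V b y = 0 → V a y = 0)
    (x0 : Fin n → Fin 2) (x : Fin M → Fin n → Fin 2) :
    (∑ i, kl (nfold V (x i)) (nfold V x0)) / M
      = flipMass x0 x 0 * kl (V 1) (V 0) + flipMass x0 x 1 * kl (V 0) (V 1) := by
  have h1 : ∀ i, kl (nfold V (x i)) (nfold V x0)
      = ∑ l, if x i l ≠ x0 l then kl (V (1 - x0 l)) (V (x0 l)) else 0 := by
    intro i
    refine (kl_prod (P := fun l => V (x i l)) (Q := fun l => V (x0 l)) (fun l => hV _)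
      fun _ _ => hac _ _ _).trans (Finset.sum_congr rfl fun l _ => ?_)
    split_ifs with h
    · rw [← eq_one_sub_of_ne h]
    · rw [not_not.1 h, kl_self]
  have h2 : (∑ i, kl (nfold V (x i)) (nfold V x0)) / M
      = ∑ l, flipFrac x0 x l * kl (V (1 - x0 l)) (V (x0 l)) := by
    simp only [h1]
    rw [Finset.sum_comm, Finset.sum_div]
    refine Finset.sum_congr rfl fun l _ => ?_
    rw [← Finset.sum_filter, Finset.sum_const, flipFrac, nsmul_eq_mul]
    ring
  rw [h2, sum_fin_two_split x0, flipMass, flipMass, Finset.sum_mul, Finset.sum_mul]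
  congr 1 <;> refine Finset.sum_congr rfl fun l hl => ?_ <;>
    rw [(Finset.mem_filter.1 hl).2] <;> rfl

theorem avg_letter {B : Type*} {V : Fin 2 → B → ℝ} (hM : 0 < M) (x0 : Fin n → Fin 2) (x : Fin M → Fin n → Fin 2) (l : Fin n)
    (z : B) : (∑ i, V (x i l) z) / M
      = (1 - flipFrac x0 x l) * V (x0 l) z + flipFrac x0 x l * V (1 - x0 l) z := by
  have hM' : (M : ℝ) ≠ 0 := by positivity
  have h1 : ∀ i, V (x i l) z
      = V (x0 l) z + if x i l ≠ x0 l then V (1 - x0 l) z - V (x0 l) z else 0 := by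
    intro i
    split_ifs with h
    · rw [← eq_one_sub_of_ne h]; ring
    · rw [not_not.1 h]; ring
  simp only [h1]
  rw [Finset.sum_add_distrib, ← Finset.sum_filter, Finset.sum_const, Finset.sum_const, flipFrac,
    nsmul_eq_mul, nsmul_eq_mul, Finset.card_univ, Fintype.card_fin]
  field_simp
  ring

/-- The divergence of a uniform mixture of codewords from a codeword is at least the sum of
squared flip fractions, weighted by chi-squared distances. -/
theorem exists_sum_sq_le_kl_avg (hV : ∀ a, V a ∈ stdSimplex ℝ B)
    (hac : ∀ a b y, V b y = 0 → V a y = 0) :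
    ∃ R : ℝ, 0 ≤ R ∧ ∀ (n M : ℕ) (x0 : Fin n → Fin 2) (x : Fin M → Fin n → Fin 2), 0 < M →
      ∑ l, flipFrac x0 x l ^ 2 * chiSq (V (1 - x0 l)) (V (x0 l)) / (2 + flipFrac x0 x l * R)
        ≤ kl (fun z => (∑ i, nfold V (x i) z) / M) (nfold V x0) := by
  have h := fun a : Fin 2 =>
    exists_le_kl_mix (hV (1 - a)) (hV a) fun b => hac (1 - a) a b
  choose R hR0 hR using h
  refine ⟨R 0 + R 1, add_nonneg (hR0 0) (hR0 1), fun n M x0 x hM => ?_⟩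
  refine le_trans (Finset.sum_le_sum fun l _ => ?_)
    (sum_kl_le_kl_avg (P := fun i l => V (x i l)) (Q := fun l => V (x0 l)) hM
      (fun _ _ => hV _) (fun _ => hV _) fun _ _ _ => ⟨hac _ _ _, hac _ _ _⟩)
  simp only [avg_letter hM x0 x l]
  refine hR (x0 l) _ ?_ _ ⟨flipFrac_nonneg _ _ _, flipFrac_le_one _ _ _⟩
  have h0 := hR0 0
  have h1 := hR0 1
  rcases fin_two_eq (x0 l) with e | e <;> rw [e] <;> linarith

/-- Each component is at most M times the uniform mixture, so its log-likelihood ratio exceeds that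
of the mixture by at most log M. Equivalently, the mutual information of M words is at most log M.
-/
theorem avg_kl_le_log_add_kl_avg (hV : ∀ a, V a ∈ stdSimplex ℝ B)
    (hac : ∀ a b y, V b y = 0 → V a y = 0) (hM : 0 < M) (x0 : Fin n → Fin 2)
    (x : Fin M → Fin n → Fin 2) :
    (∑ i, kl (nfold V (x i)) (nfold V x0)) / M
      ≤ Real.log M + kl (fun z => (∑ i, nfold V (x i) z) / M) (nfold V x0) := by
  have hM' : (0 : ℝ) < M := by positivity
  have hp : ∀ i z, nfold V (x i) z * Real.log (nfold V (x i) z / nfold V x0 z)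
      ≤ nfold V (x i) z * Real.log M + nfold V (x i) z *
        Real.log ((∑ i, nfold V (x i) z) / M / nfold V x0 z) := by
    intro i z
    have hnn : ∀ x : Fin n → Fin 2, 0 ≤ nfold V x z := fun x => (nfold_mem_stdSimplex hV x).1 z
    rcases (hnn (x i)).eq_or_lt with h | h
    · simp [← h]
    · have h0 : 0 < nfold V x0 z :=
        (hnn x0).lt_of_ne fun h0 => h.ne' (nfold_absCont hac _ _ z h0.symm)
      have hle : nfold V (x i) z ≤ ∑ i, nfold V (x i) z :=
        Finset.single_le_sum (f := fun i => nfold V (x i) z) (fun i _ => hnn _) (Finset.mem_univ i)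
      have hs : 0 < ∑ i, nfold V (x i) z := h.trans_le hle
      rw [← mul_add, ← Real.log_mul hM'.ne' (by positivity)]
      refine mul_le_mul_of_nonneg_left (Real.log_le_log (by positivity) ?_) h.le
      refine (div_le_div_of_nonneg_right hle h0.le).trans (le_of_eq ?_)
      field_simp
  have hsum : ∑ i, kl (nfold V (x i)) (nfold V x0)
      ≤ M * Real.log M + M * kl (fun z => (∑ i, nfold V (x i) z) / M) (nfold V x0) := by
    calc ∑ i, kl (nfold V (x i)) (nfold V x0)
        ≤ ∑ i, ∑ z, (nfold V (x i) z * Real.log M + nfold V (x i) z *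
          Real.log ((∑ i, nfold V (x i) z) / M / nfold V x0 z)) :=
          Finset.sum_le_sum fun i _ => Finset.sum_le_sum fun z _ => hp i z
      _ = _ := by
          simp only [Finset.sum_add_distrib, ← Finset.sum_mul,
            fun i => (nfold_mem_stdSimplex hV (x i)).2]
          rw [Finset.sum_comm]
          simp only [kl, Finset.mul_sum, ← Finset.sum_mul]
          congr 1
          · simp
          · refine Finset.sum_congr rfl fun z _ => ?_
            field_simp
  rw [div_le_iff₀ hM']
  linarith

end Memoryless

/-! ### One-shot bounds for codes -/

section OneShot

variable {Y Z : Type*} [Fintype Y] [Fintype Z] {ch : BroadcastChannel Y Z} {n M₁ M₂ : ℕ}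

theorem bob_mem_stdSimplex (ch : BroadcastChannel Y Z) (a : Fin 2) :
    ch.bob a ∈ stdSimplex ℝ Y :=
  ⟨fun _ => Finset.sum_nonneg fun _ _ => ch.nonneg _ _, by
    rw [← ch.sum_one a, Fintype.sum_prod_type]; rfl⟩

theorem willie_mem_stdSimplex (ch : BroadcastChannel Y Z) (a : Fin 2) :
    ch.willie a ∈ stdSimplex ℝ Z :=
  ⟨fun _ => Finset.sum_nonneg fun _ _ => ch.nonneg _ _, by
    rw [← ch.sum_one a, Fintype.sum_prod_type_right]; rfl⟩

theorem bob_absCont {Λ : Fin 2 → ℝ} (hch : ch.Standing Λ) (a b : Fin 2) (y : Y)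
    (h : ch.bob b y = 0) : ch.bob a y = 0 := by
  by_cases hab : a = b
  · rwa [hab]
  · exact hch.bob_ac a b hab y h

theorem willie_absCont {Λ : Fin 2 → ℝ} (hch : ch.Standing Λ) (a b : Fin 2) (y : Z)
    (h : ch.willie b y = 0) : ch.willie a y = 0 := by
  by_cases hab : a = b
  · rwa [hab]
  · exact hch.willie_ac a b hab y h

/-- The flip mass of the covert codewords of message `j` at letter `a`. -/
noncomputable def Code.mass (C : Code Y Z n M₁ M₂) (j : Fin M₂) (a : Fin 2) : ℝ :=
  flipMass (C.enc 0 j) (fun i : Fin M₁ => C.enc i.succ j) a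

theorem Code.errBobCommon_nonneg (C : Code Y Z n M₁ M₂) (j : Fin M₂) :
    0 ≤ C.errBobCommon ch j :=
  add_nonneg (outProb_nonneg (bob_mem_stdSimplex ch) _ _) (div_nonneg
    (Finset.sum_nonneg fun _ _ => outProb_nonneg (bob_mem_stdSimplex ch) _ _) (Nat.cast_nonneg _))

theorem Code.errWillie_nonneg (C : Code Y Z n M₁ M₂) (j : Fin M₂) :
    0 ≤ C.errWillie ch j :=
  add_nonneg (outProb_nonneg (willie_mem_stdSimplex ch) _ _) (div_nonneg
    (Finset.sum_nonneg fun _ _ => outProb_nonneg (willie_mem_stdSimplex ch) _ _)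
    (Nat.cast_nonneg _))

theorem Code.errBobCovert_nonneg (C : Code Y Z n M₁ M₂) (j : Fin M₂) :
    0 ≤ C.errBobCovert ch j :=
  add_nonneg (div_nonneg (outProb_nonneg (bob_mem_stdSimplex ch) _ _)
      (outProb_nonneg (bob_mem_stdSimplex ch) _ _))
    (div_nonneg (Finset.sum_nonneg fun _ _ => outProb_nonneg (bob_mem_stdSimplex ch) _ _)
      (Finset.sum_nonneg fun _ _ => outProb_nonneg (bob_mem_stdSimplex ch) _ _))

/-- Converts a conditional error probability a/b into a bound on the joint probability a. The
convention a/0 = 0 does no harm, since b = 0 forces a = 0. -/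
theorem le_div_mul_of_le {a b c : ℝ} (ha : 0 ≤ a) (hab : a ≤ b) (hbc : b ≤ c) :
    a ≤ a / b * c := by
  rcases (ha.trans hab).eq_or_lt with h | h
  · have : a = 0 := le_antisymm (h ▸ hab) ha
    simp [this]
  · calc a = a / b * b := by field_simp
      _ ≤ a / b * c := mul_le_mul_of_nonneg_left hbc (div_nonneg ha h.le)

/-- Reliability forces the covert codewords to diverge from the innocent one at Bob. -/
theorem Code.log_le_mass_bob {Λ : Fin 2 → ℝ} (hch : ch.Standing Λ) (C : Code Y Z n M₁ M₂)
    (hM : 0 < M₁) (j : Fin M₂) {η : ℝ} (h0 : 0 < η) (h1 : η ≤ 1) (hη : C.errBobCovert ch j ≤ η) :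
    (1 - C.errBobCommon ch j - C.errBobCovert ch j) * (Real.log M₁ + Real.log η⁻¹) - 1
      ≤ C.mass j 0 * kl (ch.bob 1) (ch.bob 0) + C.mass j 1 * kl (ch.bob 0) (ch.bob 1) := by
  classical
  have hV := bob_mem_stdSimplex ch
  have hac := bob_absCont hch
  have hM' : (0 : ℝ) < M₁ := by positivity
  have hM1 : (1 : ℝ) ≤ M₁ := by exact_mod_cast hM
  have hlog : 0 ≤ Real.log M₁ + Real.log η⁻¹ :=
    add_nonneg (Real.log_nonneg hM1) (Real.log_nonneg ((one_le_inv₀ h0).2 h1))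
  have het : Real.exp (Real.log M₁ + Real.log η⁻¹) = M₁ * η⁻¹ := by
    rw [Real.exp_add, Real.exp_log hM', Real.exp_log (by positivity)]
  -- Then exp t = M₁/η, where η bounds the probability that the innocent word is taken for a covert
  -- one.
  set t := Real.log M₁ + Real.log η⁻¹ with ht
  set D := {y : Fin n → Y | C.decBob₂ y = some j} with hD
  set x : Fin M₁ → Fin n → Fin 2 := fun i => C.enc i.succ j with hx
  set E : Fin M₁ → Set (Fin n → Y) := fun i => {y | C.decBob₁ y = some i.succ} ∩ D with hE
  set F : Set (Fin n → Y) := {y | C.decBob₁ y ≠ some 0 ∧ C.decBob₂ y = some j} with hF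
  have hDc : Dᶜ = {y : Fin n → Y | C.decBob₂ y ≠ some j} := rfl
  have hcommon : C.errBobCommon ch j = outProb ch.bob (C.enc 0 j) Dᶜ
      + (∑ i, outProb ch.bob (x i) Dᶜ) / M₁ := rfl
  have hcovert : C.errBobCovert ch j = outProb ch.bob (C.enc 0 j) F / outProb ch.bob (C.enc 0 j) D
      + (∑ i, outProb ch.bob (x i) ({y | C.decBob₁ y = some i.succ}ᶜ ∩ D))
        / ∑ i, outProb ch.bob (x i) D := rfl
  have hnn : ∀ w (S : Set (Fin n → Y)), 0 ≤ outProb ch.bob w S := outProb_nonneg hV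
  have hq0 : outProb ch.bob (C.enc 0 j) F ≤ outProb ch.bob (C.enc 0 j) F /
      outProb ch.bob (C.enc 0 j) D * 1 :=
    le_div_mul_of_le (hnn _ _) (outProb_mono hV _ fun y hy => hy.2) (outProb_le_one hV _ _)
  have hs : ∑ i, outProb ch.bob (x i) ({y | C.decBob₁ y = some i.succ}ᶜ ∩ D)
      ≤ (∑ i, outProb ch.bob (x i) ({y | C.decBob₁ y = some i.succ}ᶜ ∩ D))
        / (∑ i, outProb ch.bob (x i) D) * M₁ := by
    refine le_div_mul_of_le (Finset.sum_nonneg fun _ _ => hnn _ _)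
      (Finset.sum_le_sum fun i _ => outProb_mono hV _ Set.inter_subset_right) ?_
    exact (Finset.sum_le_sum fun i _ => outProb_le_one hV _ _).trans (by simp)
  have hFnn := div_nonneg (hnn (C.enc 0 j) F) (hnn (C.enc 0 j) D)
  have hGnn : 0 ≤ (∑ i, outProb ch.bob (x i) ({y | C.decBob₁ y = some i.succ}ᶜ ∩ D))
        / ∑ i, outProb ch.bob (x i) D :=
    div_nonneg (Finset.sum_nonneg fun _ _ => hnn _ _) (Finset.sum_nonneg fun _ _ => hnn _ _)
  have hq : outProb ch.bob (C.enc 0 j) F ≤ η := by linarith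
  -- Disjointness bounds by η the total over all messages, not merely each term; this is what yields
  -- the factor log M₁.
  have hsum : ∑ i, outProb ch.bob (C.enc 0 j) (E i) ≤ outProb ch.bob (C.enc 0 j) F := by
    refine sum_events_le (nfold_mem_stdSimplex hV _).1 E F ?_ ?_
    · rintro i y ⟨hy1, hy2⟩
      refine ⟨?_, hy2⟩
      rw [show C.decBob₁ y = some i.succ from hy1]
      simp [Fin.succ_ne_zero]
    · rintro i i' y ⟨hy1, -⟩ ⟨hy2, -⟩
      have : some i.succ = some i'.succ := hy1.symm.trans hy2
      simpa using this
  have hcor : M₁ * (1 - C.errBobCommon ch j - C.errBobCovert ch j)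
      ≤ ∑ i, outProb ch.bob (x i) (E i) := by
    have e : ∑ i, outProb ch.bob (x i) (E i) = M₁ - ∑ i, outProb ch.bob (x i) Dᶜ
        - ∑ i, outProb ch.bob (x i) ({y | C.decBob₁ y = some i.succ}ᶜ ∩ D) := by
      have : ∀ i, outProb ch.bob (x i) (E i) = 1 - outProb ch.bob (x i) Dᶜ
          - outProb ch.bob (x i) ({y | C.decBob₁ y = some i.succ}ᶜ ∩ D) := by
        intro i
        have h1 := outProb_inter_add_diff (V := ch.bob) (x i) {y | C.decBob₁ y = some i.succ} D
        have h2 := outProb_add_compl hV (x i) D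
        linarith
      simp only [this, Finset.sum_sub_distrib]
      simp
    have h3 : (∑ i, outProb ch.bob (x i) Dᶜ) ≤ C.errBobCommon ch j * M₁ := by
      rw [hcommon, add_mul, div_mul_cancel₀ _ hM'.ne']
      linarith [mul_nonneg (hnn (C.enc 0 j) Dᶜ) hM'.le]
    have h4 : ∑ i, outProb ch.bob (x i) ({y | C.decBob₁ y = some i.succ}ᶜ ∩ D)
        ≤ C.errBobCovert ch j * M₁ := by
      refine hs.trans (mul_le_mul_of_nonneg_right ?_ hM'.le)
      linarith
    rw [e]
    linarith
  have hdv : t * ∑ i, outProb ch.bob (x i) (E i)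
      - Real.exp t * ∑ i, outProb ch.bob (C.enc 0 j) (E i)
      ≤ ∑ i, kl (nfold ch.bob (x i)) (nfold ch.bob (C.enc 0 j)) := by
    rw [Finset.mul_sum, Finset.mul_sum, ← Finset.sum_sub_distrib]
    exact Finset.sum_le_sum fun i _ => kl_ge_event (nfold_mem_stdSimplex hV _)
      (nfold_mem_stdSimplex hV _) (nfold_absCont hac _ _) (E i) t
  have h5 := mul_le_mul_of_nonneg_left hcor hlog
  have h6 : Real.exp t * ∑ i, outProb ch.bob (C.enc 0 j) (E i) ≤ M₁ := by
    rw [het]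
    calc M₁ * η⁻¹ * ∑ i, outProb ch.bob (C.enc 0 j) (E i) ≤ M₁ * η⁻¹ * η :=
          mul_le_mul_of_nonneg_left (hsum.trans hq) (by positivity)
      _ = M₁ := by field_simp
  rw [Code.mass, Code.mass, ← avg_kl_nfold hV hac, le_div_iff₀ hM']
  nlinarith

theorem Code.mass_willie_le {Λ : Fin 2 → ℝ} (hch : ch.Standing Λ) (C : Code Y Z n M₁ M₂)
    (hM : 0 < M₁) (j : Fin M₂) :
    C.mass j 0 * kl (ch.willie 1) (ch.willie 0) + C.mass j 1 * kl (ch.willie 0) (ch.willie 1)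
      ≤ Real.log M₁ + C.divergence ch j := by
  rw [Code.mass, Code.mass, ← avg_kl_nfold (willie_mem_stdSimplex ch) (willie_absCont hch)]
  exact avg_kl_le_log_add_kl_avg (willie_mem_stdSimplex ch) (willie_absCont hch) hM _ _

/-- Covertness bounds the squared flip masses, with a constant that tends to the optimal one as
the divergence vanishes. -/
theorem exists_mass_sq_le {Λ : Fin 2 → ℝ} (hch : ch.Standing Λ) :
    ∃ K : ℝ, 0 ≤ K ∧ ∀ (n M₁ M₂ : ℕ) (C : Code Y Z n M₁ M₂) (j : Fin M₂), 0 < M₁ →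
      0 ≤ C.divergence ch j ∧ ∃ S₀ S₁ : ℝ, 0 ≤ S₀ ∧ 0 ≤ S₁ ∧
      C.mass j 0 ^ 2 ≤ (n - n * C.weightFraction j) * S₀ ∧
      C.mass j 1 ^ 2 ≤ n * C.weightFraction j * S₁ ∧
      chiSq (ch.willie 1) (ch.willie 0) * S₀ + chiSq (ch.willie 0) (ch.willie 1) * S₁
        ≤ (2 + K * √(C.divergence ch j)) * C.divergence ch j := by
  have hV := willie_mem_stdSimplex ch
  have hac := willie_absCont hch
  obtain ⟨R, hR, h⟩ := exists_sum_sq_le_kl_avg hV hac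
  have hc : ∀ a : Fin 2, 0 < chiSq (ch.willie (1 - a)) (ch.willie a) := by
    intro a
    refine chiSq_pos (hV a) (fun b => hac _ _ b) fun e => hch.willie_ne ?_
    rcases fin_two_eq a with rfl | rfl
    · exact e.symm
    · exact e
  set c := min (chiSq (ch.willie 1) (ch.willie 0)) (chiSq (ch.willie 0) (ch.willie 1)) with hcdef
  have hc0 : 0 < c := lt_min (hc 0) (hc 1)
  have hca : ∀ a : Fin 2, c ≤ chiSq (ch.willie (1 - a)) (ch.willie a) := by
    intro a
    rcases fin_two_eq a with rfl | rfl
    · exact min_le_left _ _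
    · exact min_le_right _ _
  -- A single term of the sum already gives α_l ≤ √((2+R)/c) √δ, so the correction α_l R in the
  -- denominators is at most K√δ.
  refine ⟨√((2 + R) / c) * R, by positivity, fun n M₁ M₂ C j hM => ?_⟩
  set x0 := C.enc 0 j with hx0
  set x : Fin M₁ → Fin n → Fin 2 := fun i => C.enc i.succ j with hx
  have hle := h n M₁ x0 x hM
  set δ := C.divergence ch j with hδ
  change _ ≤ δ at hle
  have hα0 := flipFrac_nonneg x0 x
  have hα1 := flipFrac_le_one x0 x
  set α := flipFrac x0 x with hα
  have hterm : ∀ l, 0 ≤ α l ^ 2 * chiSq (ch.willie (1 - x0 l)) (ch.willie (x0 l))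
      / (2 + α l * R) := fun l =>
    div_nonneg (mul_nonneg (sq_nonneg _) (hc _).le) (by have := mul_nonneg (hα0 l) hR; linarith)
  have hδ0 : 0 ≤ δ := (Finset.sum_nonneg fun l _ => hterm l).trans hle
  have hsmall : ∀ l, α l ≤ √((2 + R) / c) * √δ := by
    intro l
    have h1 := (Finset.single_le_sum (fun l _ => hterm l) (Finset.mem_univ l)).trans hle
    have h2 : α l ^ 2 * c / (2 + R) ≤ δ := by
      refine le_trans ?_ h1
      have := hca (x0 l)
      have h3 := mul_nonneg (hα0 l) hR
      have h4 : α l * R ≤ R := by nlinarith [hα1 l]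
      have h5 := mul_nonneg (sq_nonneg (α l)) (hc (x0 l)).le
      gcongr
    rw [← Real.sqrt_mul (by positivity)]
    refine Real.le_sqrt_of_sq_le ?_
    rw [div_le_iff₀ (by positivity)] at h2
    rw [div_mul_eq_mul_div, le_div_iff₀ hc0]
    linarith
  have hcard : ∑ l with x0 l = 1, (1 : ℝ) = n * C.weightFraction j := by
    rw [Code.weightFraction, Finset.sum_const, nsmul_eq_mul, mul_one]
    -- At block length 0 the weight fraction is 0/0 = 0 and both sides vanish.
    rcases Nat.eq_zero_or_pos n with h0 | h0
    · subst h0; simp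
    · rw [mul_div_cancel₀ _ (by positivity)]
  have hcard0 : ∑ l with x0 l = 0, (1 : ℝ) = n - n * C.weightFraction j := by
    have := sum_fin_two_split x0 fun _ => (1 : ℝ)
    rw [hcard] at this
    simp only [Finset.sum_const, Finset.card_univ, Fintype.card_fin, nsmul_eq_mul, mul_one]
      at this ⊢
    linarith
  have hcs : ∀ a, C.mass j a ^ 2 ≤ (∑ l with x0 l = a, (1 : ℝ)) * ∑ l with x0 l = a, α l ^ 2 := by
    intro a
    have := Finset.sum_mul_sq_le_sq_mul_sq (Finset.univ.filter fun l => x0 l = a)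
      (fun _ => (1 : ℝ)) α
    simpa [Code.mass, flipMass] using this
  refine ⟨hδ0, ∑ l with x0 l = 0, α l ^ 2, ∑ l with x0 l = 1, α l ^ 2,
    Finset.sum_nonneg fun _ _ => sq_nonneg _, Finset.sum_nonneg fun _ _ => sq_nonneg _,
    hcard0 ▸ hcs 0, hcard ▸ hcs 1, ?_⟩
  have hden : 0 < 2 + √((2 + R) / c) * R * √δ := by positivity
  have hfin : (∑ l, α l ^ 2 * chiSq (ch.willie (1 - x0 l)) (ch.willie (x0 l)))
      / (2 + √((2 + R) / c) * R * √δ) ≤ δ := by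
    refine le_trans ?_ hle
    rw [Finset.sum_div]
    refine Finset.sum_le_sum fun l _ => ?_
    have h3 := mul_nonneg (hα0 l) hR
    have h4 := mul_le_mul_of_nonneg_right (hsmall l) hR
    have h5 := mul_nonneg (sq_nonneg (α l)) (hc (x0 l)).le
    refine div_le_div_of_nonneg_left h5 (by linarith) ?_
    linarith
  rw [div_le_iff₀ hden, sum_fin_two_split x0] at hfin
  rw [Finset.mul_sum, Finset.mul_sum, mul_comm _ δ]
  refine le_trans (le_of_eq ?_) hfin
  congr 1 <;> refine Finset.sum_congr rfl fun l hl => ?_ <;>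
    rw [(Finset.mem_filter.1 hl).2, mul_comm] <;> rfl

end OneShot

/-! ### Weights of the innocent codewords -/

section Weight

variable {B : Type*} [Fintype B] {V : Fin 2 → B → ℝ} {Λ : Fin 2 → ℝ}

/-- The binary law with mass `p` at `1`. -/
def binLaw (p : ℝ) : Fin 2 → ℝ := ![1 - p, p]

/-- The output law of the channel `V` under the input law `p`. -/
def outLaw (V : Fin 2 → B → ℝ) (p : Fin 2 → ℝ) (b : B) : ℝ := ∑ x, p x * V x b

theorem mutualInfo_eq (p : Fin 2 → ℝ) (V : Fin 2 → B → ℝ) :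
    mutualInfo p V = p 0 * kl (V 0) (outLaw V p) + p 1 * kl (V 1) (outLaw V p) := by
  rw [mutualInfo, Fin.sum_univ_two]; rfl

theorem binLaw_mem {p : ℝ} (h0 : 0 ≤ p) (h1 : p ≤ 1) : binLaw p ∈ stdSimplex ℝ (Fin 2) := by
  refine ⟨fun a => ?_, ?_⟩
  · rcases fin_two_eq a with rfl | rfl <;> simp [binLaw, h0, h1]
  · simp [binLaw, Fin.sum_univ_two]

theorem outLaw_mem {p : Fin 2 → ℝ} (hp : p ∈ stdSimplex ℝ (Fin 2))
    (hV : ∀ a, V a ∈ stdSimplex ℝ B) : outLaw V p ∈ stdSimplex ℝ B := by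
  refine ⟨fun b => Finset.sum_nonneg fun a _ => mul_nonneg (hp.1 a) ((hV a).1 b), ?_⟩
  simp only [outLaw]
  rw [Finset.sum_comm]
  simp only [← Finset.mul_sum, fun a => (hV a).2, mul_one, hp.2]

theorem outLaw_pos {p : Fin 2 → ℝ} (hp : ∀ a, 0 < p a) (hV : ∀ a, V a ∈ stdSimplex ℝ B)
    {a : Fin 2} {b : B} (h : 0 < V a b) : 0 < outLaw V p b :=
  Finset.sum_pos' (fun a _ => mul_nonneg (hp a).le ((hV a).1 b))
    ⟨a, Finset.mem_univ a, mul_pos (hp a) h⟩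

theorem outLaw_absCont {p : Fin 2 → ℝ} (hp : ∀ a, 0 < p a) (hV : ∀ a, V a ∈ stdSimplex ℝ B)
    (a : Fin 2) (b : B) (h : outLaw V p b = 0) : V a b = 0 :=
  le_antisymm (not_lt.1 fun h0 => (outLaw_pos hp hV h0).ne' h) ((hV a).1 b)

/-- Replacing the induced output law by another one increases the average divergence. -/
theorem mutualInfo_le {p q : Fin 2 → ℝ} (hV : ∀ a, V a ∈ stdSimplex ℝ B)
    (hp : p ∈ stdSimplex ℝ (Fin 2)) (hq : q ∈ stdSimplex ℝ (Fin 2))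
    (hp0 : ∀ a, 0 < p a) (hq0 : ∀ a, 0 < q a) :
    mutualInfo p V ≤ p 0 * kl (V 0) (outLaw V q) + p 1 * kl (V 1) (outLaw V q) := by
  have h1 : ∀ a, kl (V a) (outLaw V q) = kl (V a) (outLaw V p)
      + ∑ b, V a b * Real.log (outLaw V p b / outLaw V q b) := by
    intro a
    rw [kl, kl, ← Finset.sum_add_distrib]
    refine Finset.sum_congr rfl fun b _ => ?_
    rcases ((hV a).1 b).eq_or_lt with h | h
    · simp [← h]
    · have hpp := outLaw_pos hp0 hV h
      have hqq := outLaw_pos hq0 hV h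
      rw [Real.log_div h.ne' hqq.ne', Real.log_div h.ne' hpp.ne', Real.log_div hpp.ne' hqq.ne']
      ring
  have h2 : 0 ≤ kl (outLaw V p) (outLaw V q) := by
    refine kl_nonneg (outLaw_mem hp hV) (outLaw_mem hq hV) fun b hb => ?_
    have := fun a => outLaw_absCont hq0 hV a b hb
    simp [outLaw, this]
  have h3 : kl (outLaw V p) (outLaw V q)
      = p 0 * ∑ b, V 0 b * Real.log (outLaw V p b / outLaw V q b)
        + p 1 * ∑ b, V 1 b * Real.log (outLaw V p b / outLaw V q b) := by
    rw [kl, Finset.mul_sum, Finset.mul_sum, ← Finset.sum_add_distrib]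
    refine Finset.sum_congr rfl fun b _ => ?_
    conv_lhs => rw [show outLaw V p b * Real.log (outLaw V p b / outLaw V q b)
      = (∑ x, p x * V x b) * Real.log (outLaw V p b / outLaw V q b) from rfl, Fin.sum_univ_two]
    ring
  rw [mutualInfo_eq, h1, h1]
  linarith

theorem mutualInfo_binLaw_zero (V : Fin 2 → B → ℝ) : mutualInfo (binLaw 0) V = 0 := by
  have : outLaw V (binLaw 0) = V 0 := by
    ext b; simp [outLaw, binLaw, Fin.sum_univ_two]
  rw [mutualInfo_eq, this, kl_self]
  simp [binLaw]

/-- At capacity zero the point mass at 0 would also achieve capacity, contradicting uniqueness with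
`Λ 1 > 0`. -/
theorem mutualInfo_pos_of_unique (hΛ : AchievesCapacity V Λ)
    (huniq : ∀ p, AchievesCapacity V p → p = Λ) (hpos : 0 < Λ 1) : 0 < mutualInfo Λ V := by
  by_contra h
  have : binLaw 0 = Λ := huniq _ ⟨binLaw_mem le_rfl zero_le_one, fun p hp => by
    rw [mutualInfo_binLaw_zero]; linarith [hΛ.2 p hp]⟩
  rw [← this] at hpos
  simp [binLaw] at hpos

theorem zero_apply_eq {p : Fin 2 → ℝ} (hp : p ∈ stdSimplex ℝ (Fin 2)) : p 0 = 1 - p 1 := by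
  have := hp.2
  rw [Fin.sum_univ_two] at this
  linarith

theorem lt_one_of_unique (hΛ : AchievesCapacity V Λ)
    (huniq : ∀ p, AchievesCapacity V p → p = Λ) (hpos : 0 < Λ 1) : Λ 1 < 1 := by
  have h0 := zero_apply_eq hΛ.1
  refine lt_of_le_of_ne (by linarith [hΛ.1.1 0]) fun h => ?_
  have hI := mutualInfo_pos_of_unique hΛ huniq hpos
  have : outLaw V Λ = V 1 := by
    ext b; simp [outLaw, Fin.sum_univ_two, h0, h]
  rw [mutualInfo_eq, this, kl_self, h0, h] at hI
  simp at hI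

theorem mutualInfo_binLaw_lt (hΛ : AchievesCapacity V Λ)
    (huniq : ∀ p, AchievesCapacity V p → p = Λ) {p : ℝ} (h0 : 0 ≤ p) (h1 : p ≤ 1)
    (hp : p ≠ Λ 1) : mutualInfo (binLaw p) V < mutualInfo Λ V := by
  refine lt_of_le_of_ne (hΛ.2 _ (binLaw_mem h0 h1)) fun h => hp ?_
  have := huniq _ ⟨binLaw_mem h0 h1, fun q hq => h ▸ hΛ.2 q hq⟩
  simpa [binLaw] using congrFun this 1

/-- A codeword whose fraction of ones `w` lies on the far side of `p` as seen from the
capacity-achieving `Λ 1` carries at most the information rate of the input law `p`. -/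
theorem divergence_rate_le (hV : ∀ a, V a ∈ stdSimplex ℝ B) (hΛ : AchievesCapacity V Λ)
    (huniq : ∀ p, AchievesCapacity V p → p = Λ) (hpos : 0 < Λ 1) {p w : ℝ} (h0 : 0 < p)
    (h1 : p < 1) (hp : p ≠ Λ 1) (hw : 0 ≤ (w - p) * (p - Λ 1)) :
    (1 - w) * kl (V 0) (outLaw V (binLaw p)) + w * kl (V 1) (outLaw V (binLaw p))
      ≤ mutualInfo (binLaw p) V := by
  have hz := zero_apply_eq hΛ.1
  have hlt := lt_one_of_unique hΛ huniq hpos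
  have hI := mutualInfo_binLaw_lt hΛ huniq h0.le h1.le hp
  have hle := mutualInfo_le (p := Λ) (q := binLaw p) hV hΛ.1 (binLaw_mem h0.le h1.le)
    (fun a => by rcases fin_two_eq a with rfl | rfl <;> linarith)
    (fun a => by rcases fin_two_eq a with rfl | rfl <;> simp [binLaw, h0, h1])
  have hmi := mutualInfo_eq (binLaw p) V
  rw [show binLaw p 0 = 1 - p from rfl, show binLaw p 1 = p from rfl] at hmi
  set k0 := kl (V 0) (outLaw V (binLaw p))
  set k1 := kl (V 1) (outLaw V (binLaw p))
  rw [hmi] at hI ⊢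
  rw [hz] at hle
  -- Against the fixed output law of `p`, the rate is affine in the weight. It equals I(p) at weight
  -- p and is at least I(Λ) > I(p) at weight `Λ 1`, so it grows towards `Λ 1` and does not exceed
  -- I(p) on the far side of p.
  have hs : 0 < (Λ 1 - p) * (k1 - k0) := by nlinarith
  have hne : 0 < (p - Λ 1) ^ 2 := by have := sub_ne_zero.2 hp; positivity
  have h3 : 0 ≤ ((w - p) * (p - Λ 1)) * ((Λ 1 - p) * (k1 - k0)) := mul_nonneg hw hs.le
  have h4 : 0 ≤ -((w - p) * (k1 - k0)) := by
    refine le_of_mul_le_mul_right ?_ hne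
    nlinarith
  nlinarith

theorem kl_nfold_const {n : ℕ} (hV : ∀ a, V a ∈ stdSimplex ℝ B) {q : B → ℝ}
    (hac : ∀ a b, q b = 0 → V a b = 0) (x : Fin n → Fin 2) :
    kl (nfold V x) (fun b => ∏ l, q (b l))
      = n * ((1 - ((Finset.univ.filter fun l => x l = 1).card : ℝ) / n) * kl (V 0) q
        + ((Finset.univ.filter fun l => x l = 1).card : ℝ) / n * kl (V 1) q) := by
  have h := kl_prod (P := fun l => V (x l)) (Q := fun _ : Fin n => q) (fun l => hV _)
    fun _ => hac _
  have h1 : kl (nfold V x) (fun b => ∏ l, q (b l)) = ∑ l, kl (V (x l)) q := h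
  rcases Nat.eq_zero_or_pos n with h0 | h0
  · subst h0; rw [h1]; simp
  have h2 : ∑ l, kl (V (x l)) q
      = ∑ l, (kl (V 0) q + if x l = 1 then kl (V 1) q - kl (V 0) q else 0) := by
    refine Finset.sum_congr rfl fun l _ => ?_
    rcases fin_two_eq (x l) with e | e <;> simp [e]
  have hn : (n : ℝ) ≠ 0 := by positivity
  rw [h1, h2, Finset.sum_add_distrib, ← Finset.sum_filter, Finset.sum_const, Finset.sum_const]
  simp only [Finset.card_univ, Fintype.card_fin, nsmul_eq_mul]
  field_simp
  ring

end Weight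

/-! ### Typicality of the innocent codewords and selection of good messages -/

section Typicality

variable {Y Z : Type*} [Fintype Y] [Fintype Z] {ch : BroadcastChannel Y Z} {Λ : Fin 2 → ℝ}

open Classical in
/-- The fraction of common messages whose innocent codeword has its weight beyond `p`. -/
noncomputable def Code.farFraction {Y Z : Type*} {n M₁ M₂ : ℕ} (C : Code Y Z n M₁ M₂) (lam p : ℝ) : ℝ :=
  ((Finset.univ.filter fun j => 0 ≤ (C.weightFraction j - p) * (p - lam)).card : ℝ) / M₂

theorem Code.farFraction_nonneg {Y Z : Type*} {n M₁ M₂ : ℕ} (C : Code Y Z n M₁ M₂) (lam p : ℝ) :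
    0 ≤ C.farFraction lam p := by
  unfold Code.farFraction; positivity

/-- A weak converse for the far messages alone. The event bound with t = log M₂ is applied to
Willie's decoding regions, against the product output law of `p`. The divergences are at most n
I(p), and disjointness of the regions accounts for the final 1. -/
theorem Code.farFraction_mul_le (hch : ch.Standing Λ) {n M₁ M₂ : ℕ} (C : Code Y Z n M₁ M₂)
    (hM : 0 < M₂) {p : ℝ} (h0 : 0 < p) (h1 : p < 1) (hp : p ≠ Λ 1) :
    C.farFraction (Λ 1) p * (Real.log M₂ - n * mutualInfo (binLaw p) ch.willie)
      ≤ Real.log M₂ * C.willieError ch + 1 := by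
  classical
  have hV := willie_mem_stdSimplex ch
  have hM' : (0 : ℝ) < M₂ := by positivity
  have hlog : 0 ≤ Real.log M₂ := Real.log_nonneg (by exact_mod_cast hM)
  have hb0 : ∀ a, 0 < binLaw p a := fun a => by
    rcases fin_two_eq a with rfl | rfl <;> simp [binLaw, h0, h1]
  set q := outLaw ch.willie (binLaw p) with hq
  have hqm : q ∈ stdSimplex ℝ Z := outLaw_mem (binLaw_mem h0.le h1.le) hV
  have hqac : ∀ a b, q b = 0 → ch.willie a b = 0 := outLaw_absCont hb0 hV
  set qn : (Fin n → Z) → ℝ := fun b => ∏ l, q (b l) with hqn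
  have hqnm : qn ∈ stdSimplex ℝ (Fin n → Z) := prod_mem_stdSimplex fun _ => hqm
  set S := Finset.univ.filter fun j => 0 ≤ (C.weightFraction j - p) * (p - Λ 1) with hS
  have hfar : C.farFraction (Λ 1) p = (S.card : ℝ) / M₂ := rfl
  obtain ⟨E, hE⟩ : ∃ E : Fin M₂ → Set (Fin n → Z), ∀ j z, z ∈ E j ↔ C.decWillie z = some j :=
    ⟨fun j => {z | C.decWillie z = some j}, fun _ _ => Iff.rfl⟩
  have hEc : ∀ j, (E j)ᶜ = {z | C.decWillie z ≠ some j} := fun j => by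
    ext z; simp [hE]
  have hup : ∀ j ∈ S, kl (nfold ch.willie (C.enc 0 j)) qn
      ≤ n * mutualInfo (binLaw p) ch.willie := by
    intro j hj
    rw [hqn, kl_nfold_const hV hqac]
    exact mul_le_mul_of_nonneg_left (divergence_rate_le hV hch.capacity hch.capacity_unique
      hch.pos h0 h1 hp (Finset.mem_filter.1 hj).2) (Nat.cast_nonneg n)
  have hlow : ∀ j, Real.log M₂ * (1 - C.errWillie ch j)
      - M₂ * (∑ b, if b ∈ E j then qn b else 0) ≤ kl (nfold ch.willie (C.enc 0 j)) qn := by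
    intro j
    have h := kl_ge_event (nfold_mem_stdSimplex hV (C.enc 0 j)) hqnm
      (prod_absCont fun l b => hqac (C.enc 0 j l) b) (E j) (Real.log M₂)
    rw [Real.exp_log hM'] at h
    refine le_trans (sub_le_sub_right (mul_le_mul_of_nonneg_left ?_ hlog) _) h
    have h2 := outProb_add_compl hV (C.enc 0 j) (E j)
    rw [hEc] at h2
    have h3 : C.errWillie ch j = outProb ch.willie (C.enc 0 j) {z | C.decWillie z ≠ some j}
      + (∑ i : Fin M₁, outProb ch.willie (C.enc i.succ j) {z | C.decWillie z ≠ some j}) / M₁ := rfl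
    have h4 : 0 ≤ (∑ i : Fin M₁, outProb ch.willie (C.enc i.succ j)
        {z | C.decWillie z ≠ some j}) / M₁ :=
      div_nonneg (Finset.sum_nonneg fun _ _ => outProb_nonneg hV _ _) (Nat.cast_nonneg _)
    change _ ≤ outProb ch.willie (C.enc 0 j) (E j)
    linarith
  have hqE : ∑ j ∈ S, (∑ b, if b ∈ E j then qn b else 0) ≤ 1 := by
    refine le_trans (Finset.sum_le_sum_of_subset_of_nonneg (Finset.subset_univ S) fun j _ _ =>
      Finset.sum_nonneg fun b _ => ?_) ((sum_events_le hqnm.1 E Set.univ (fun _ => Set.subset_univ _)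
      ?_).trans ?_)
    · have := hqnm.1 b
      split_ifs <;> simp [this]
    · intro i i' b hi hi'
      simpa using ((hE _ _).1 hi).symm.trans ((hE _ _).1 hi')
    · simpa using hqnm.2.le
  have herr : ∑ j ∈ S, C.errWillie ch j ≤ M₂ * C.willieError ch := by
    rw [Code.willieError, mul_div_cancel₀ _ hM'.ne']
    exact Finset.sum_le_sum_of_subset_of_nonneg (Finset.subset_univ S)
      fun j _ _ => C.errWillie_nonneg j
  have htot := Finset.sum_le_sum fun j hj => (hlow j).trans (hup j hj)
  simp only [Finset.sum_sub_distrib, ← Finset.mul_sum, Finset.sum_const, nsmul_eq_mul,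
    mul_one] at htot
  rw [hfar, div_mul_eq_mul_div, div_le_iff₀ hM']
  have h5 := mul_le_mul_of_nonneg_left hqE hM'.le
  have h6 := mul_le_mul_of_nonneg_left herr hlog
  nlinarith

theorem tendsto_farFraction (hch : ch.Standing Λ) {n M₁ M₂ : ℕ → ℕ}
    (C : ∀ k, Code Y Z (n k) (M₁ k) (M₂ k)) (hn : Tendsto n atTop atTop) (hM : ∀ k, 0 < M₂ k)
    (herr : Tendsto (fun k => (C k).willieError ch) atTop (𝓝 0))
    (hrate : Tendsto (fun k => Real.log (M₂ k) / n k) atTop (𝓝 (mutualInfo Λ ch.willie)))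
    {p : ℝ} (h0 : 0 < p) (h1 : p < 1) (hp : p ≠ Λ 1) :
    Tendsto (fun k => (C k).farFraction (Λ 1) p) atTop (𝓝 0) := by
  have hI := mutualInfo_binLaw_lt hch.capacity hch.capacity_unique h0.le h1.le hp
  set I := mutualInfo (binLaw p) ch.willie
  set R := mutualInfo Λ ch.willie
  have hninv : Tendsto (fun k => 1 / (n k : ℝ)) atTop (𝓝 0) :=
    tendsto_one_div_atTop_nhds_zero_nat.comp hn
  have hnum : Tendsto (fun k => Real.log (M₂ k) / n k * (C k).willieError ch + 1 / (n k : ℝ))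
      atTop (𝓝 0) := by
    simpa using (hrate.mul herr).add hninv
  have hden : Tendsto (fun k => Real.log (M₂ k) / n k - I) atTop (𝓝 (R - I)) :=
    hrate.sub_const I
  have hquot := hnum.div hden (sub_pos.2 hI).ne'
  rw [zero_div] at hquot
  refine squeeze_zero' (Eventually.of_forall fun k => (C k).farFraction_nonneg _ _) ?_ hquot
  filter_upwards [hden.eventually (lt_mem_nhds (sub_pos.2 hI)), hn.eventually_gt_atTop 0]
    with k hk hnk
  have hnk' : (0 : ℝ) < n k := by exact_mod_cast hnk
  have h := (C k).farFraction_mul_le hch (hM k) h0 h1 hp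
  simp only [Pi.div_apply]
  rw [le_div_iff₀ hk]
  refine le_of_mul_le_mul_right ?_ hnk'
  calc _ = (C k).farFraction (Λ 1) p * (Real.log (M₂ k) - n k * I) := by field_simp
    _ ≤ _ := h
    _ = _ := by field_simp

theorem Code.weightFraction_mem {Y Z : Type*} {n M₁ M₂ : ℕ} (C : Code Y Z n M₁ M₂) (j : Fin M₂) :
    C.weightFraction j ∈ Set.Icc (0 : ℝ) 1 := by
  refine ⟨by unfold Code.weightFraction; positivity, div_le_one_of_le₀ ?_ (Nat.cast_nonneg n)⟩
  exact_mod_cast (Finset.card_le_univ _).trans (by simp)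

/-- A deviation above ε puts the weight beyond lam + ε or lam - ε, and no deviation exceeds 1. -/
theorem Code.avg_abs_weight_le {Y Z : Type*} {n M₁ M₂ : ℕ} (C : Code Y Z n M₁ M₂) (hM : 0 < M₂)
    {lam ε : ℝ} (h0 : 0 ≤ lam) (h1 : lam ≤ 1) (hε : 0 ≤ ε) :
    (∑ j, |C.weightFraction j - lam|) / M₂
      ≤ ε + C.farFraction lam (lam + ε) + C.farFraction lam (lam - ε) := by
  classical
  have hM' : (0 : ℝ) < M₂ := by positivity
  have hpt : ∀ j, |C.weightFraction j - lam| ≤ ε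
      + (if 0 ≤ (C.weightFraction j - (lam + ε)) * ((lam + ε) - lam) then 1 else 0)
      + (if 0 ≤ (C.weightFraction j - (lam - ε)) * ((lam - ε) - lam) then 1 else 0) := by
    intro j
    have hw := C.weightFraction_mem j
    have habs : |C.weightFraction j - lam| ≤ 1 := abs_le.2 ⟨by linarith [hw.1], by linarith [hw.2]⟩
    have i0 : ∀ P : Prop, [Decidable P] → (0 : ℝ) ≤ if P then 1 else 0 := fun P _ => by
      split_ifs <;> norm_num
    by_cases hc : |C.weightFraction j - lam| ≤ ε
    · linarith [i0 (0 ≤ (C.weightFraction j - (lam + ε)) * ((lam + ε) - lam)),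
        i0 (0 ≤ (C.weightFraction j - (lam - ε)) * ((lam - ε) - lam))]
    · rcases lt_abs.1 (not_le.1 hc) with h | h
      · rw [if_pos (show 0 ≤ (C.weightFraction j - (lam + ε)) * ((lam + ε) - lam) from
          mul_nonneg (by linarith) (by linarith))]
        linarith [i0 (0 ≤ (C.weightFraction j - (lam - ε)) * ((lam - ε) - lam))]
      · rw [if_pos (show 0 ≤ (C.weightFraction j - (lam - ε)) * ((lam - ε) - lam) from
          mul_nonneg_of_nonpos_of_nonpos (by linarith) (by linarith))]
        linarith [i0 (0 ≤ (C.weightFraction j - (lam + ε)) * ((lam + ε) - lam))]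
  rw [div_le_iff₀ hM']
  refine (Finset.sum_le_sum fun j _ => hpt j).trans (le_of_eq ?_)
  rw [Finset.sum_add_distrib, Finset.sum_add_distrib, Finset.sum_boole, Finset.sum_boole,
    Code.farFraction, Code.farFraction]
  simp only [Finset.sum_const, Finset.card_univ, Fintype.card_fin, nsmul_eq_mul]
  rw [add_mul, add_mul, div_mul_cancel₀ _ hM'.ne', div_mul_cancel₀ _ hM'.ne', mul_comm]

theorem tendsto_avg_abs_weight (hch : ch.Standing Λ) {n M₁ M₂ : ℕ → ℕ}
    (C : ∀ k, Code Y Z (n k) (M₁ k) (M₂ k)) (hn : Tendsto n atTop atTop) (hM : ∀ k, 0 < M₂ k)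
    (herr : Tendsto (fun k => (C k).willieError ch) atTop (𝓝 0))
    (hrate : Tendsto (fun k => Real.log (M₂ k) / n k) atTop (𝓝 (mutualInfo Λ ch.willie))) :
    Tendsto (fun k => (∑ j, |(C k).weightFraction j - Λ 1|) / M₂ k) atTop (𝓝 0) := by
  have hpos := hch.pos
  have hlt := lt_one_of_unique hch.capacity hch.capacity_unique hch.pos
  rw [Metric.tendsto_nhds]
  intro r hr
  -- Besides being below r/2, ε must keep `Λ 1 ± ε` strictly inside (0, 1), where the far-fraction
  -- bound applies.
  obtain ⟨ε, hε0, hε⟩ := exists_between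
    (show 0 < min (r / 2) (min (Λ 1) (1 - Λ 1)) from lt_min (by linarith)
      (lt_min hpos (by linarith)))
  obtain ⟨hεr, hε1, hε2⟩ : ε < r / 2 ∧ ε < Λ 1 ∧ ε < 1 - Λ 1 := by simpa using hε
  have hA := tendsto_farFraction hch C hn hM herr hrate (p := Λ 1 + ε) (by linarith) (by linarith)
    (by linarith)
  have hB := tendsto_farFraction hch C hn hM herr hrate (p := Λ 1 - ε) (by linarith) (by linarith)
    (by linarith)
  filter_upwards [hA.eventually (gt_mem_nhds (show (0 : ℝ) < r / 4 by linarith)),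
    hB.eventually (gt_mem_nhds (show (0 : ℝ) < r / 4 by linarith))] with k hkA hkB
  have h := (C k).avg_abs_weight_le (hM k) hpos.le hlt.le hε0.le
  rw [Real.dist_eq, sub_zero, abs_of_nonneg (by positivity)]
  linarith

/-- A nonnegative array whose row averages vanish is uniformly small off a vanishing fraction of
each row. -/
theorem exists_large_small_sets {M : ℕ → ℕ} (hM : ∀ k, 0 < M k) (β : ∀ k, Fin (M k) → ℝ)
    (hβ : ∀ k j, 0 ≤ β k j) (h : Tendsto (fun k => (∑ j, β k j) / M k) atTop (𝓝 0)) :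
    ∃ G : ∀ k, Finset (Fin (M k)), Tendsto (fun k => ((G k).card : ℝ) / M k) atTop (𝓝 1) ∧
      ∃ r : ℕ → ℝ, Tendsto r atTop (𝓝 0) ∧ ∀ k, ∀ j ∈ G k, β k j ≤ r k := by
  classical
  set a : ℕ → ℝ := fun k => (∑ j, β k j) / M k with ha
  have ha0 : ∀ k, 0 ≤ a k := fun k =>
    div_nonneg (Finset.sum_nonneg fun j _ => hβ k j) (Nat.cast_nonneg _)
  have hs : Tendsto (fun k => √(a k)) atTop (𝓝 0) := by
    simpa using h.sqrt
  -- Markov's inequality at the square root of the average: the threshold and the excluded fraction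
  -- both vanish.
  refine ⟨fun k => Finset.univ.filter fun j => β k j ≤ √(a k), ?_, fun k => √(a k), hs,
    fun k j hj => (Finset.mem_filter.1 hj).2⟩
  refine tendsto_of_tendsto_of_tendsto_of_le_of_le
    (by simpa using tendsto_const_nhds.sub hs : Tendsto (fun k => 1 - √(a k)) atTop (𝓝 1))
    tendsto_const_nhds (fun k => ?_) fun k => ?_
  · have hM' : (0 : ℝ) < M k := by exact_mod_cast hM k
    have hsplit := Finset.card_filter_add_card_filter_not (s := Finset.univ)
      (fun j => β k j ≤ √(a k))
    rw [Finset.card_univ, Fintype.card_fin] at hsplit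
    have hsplit' : ((Finset.univ.filter fun j => β k j ≤ √(a k)).card : ℝ)
        + ((Finset.univ.filter fun j => ¬β k j ≤ √(a k)).card : ℝ) = M k := by
      exact_mod_cast hsplit
    have hmarkov : ((Finset.univ.filter fun j => ¬β k j ≤ √(a k)).card : ℝ) * √(a k)
        ≤ a k * M k := by
      rw [ha]
      simp only
      rw [div_mul_cancel₀ _ hM'.ne', ← nsmul_eq_mul]
      refine (Finset.card_nsmul_le_sum _ _ _ fun j hj =>
        (not_le.1 (Finset.mem_filter.1 hj).2).le).trans ?_
      exact Finset.sum_le_sum_of_subset_of_nonneg (Finset.filter_subset _ _) fun j _ _ => hβ k j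
    have hbad : ((Finset.univ.filter fun j => ¬β k j ≤ √(a k)).card : ℝ) ≤ √(a k) * M k := by
      -- At threshold 0 Markov's inequality says nothing, but then the whole row is zero.
      rcases (Real.sqrt_nonneg (a k)).eq_or_lt with h0 | h0
      · have ha00 : ∑ j, β k j = 0 := by
          have : a k = 0 := le_antisymm (Real.sqrt_eq_zero'.1 h0.symm) (ha0 k)
          rw [ha] at this
          simpa [hM'.ne'] using this
        have hz := (Finset.sum_eq_zero_iff_of_nonneg fun j _ => hβ k j).1 ha00
        rw [← h0, zero_mul, Finset.filter_false_of_mem]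
        · simp
        · intro j hj
          simp [hz j hj]
      · refine le_of_mul_le_mul_right (hmarkov.trans (le_of_eq ?_)) h0
        conv_lhs => rw [← Real.mul_self_sqrt (ha0 k)]
        ring
    simp only
    rw [le_div_iff₀ hM']
    linarith
  · refine div_le_one_of_le₀ ?_ (Nat.cast_nonneg _)
    have := Finset.card_le_univ (Finset.univ.filter fun j => β k j ≤ √(a k))
    rw [Fintype.card_fin] at this
    exact Nat.cast_le.2 this

/-- Both error metrics and the weight deviation are nonnegative, so one selection applied to their
sum controls all three at a common rate. -/
theorem exists_reliableTypical (hch : ch.Standing Λ) {n M₁ M₂ : ℕ → ℕ}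
    (C : ∀ k, Code Y Z (n k) (M₁ k) (M₂ k)) (hn : Tendsto n atTop atTop) (hM : ∀ k, 0 < M₂ k)
    (hbob : Tendsto (fun k => (C k).bobError ch) atTop (𝓝 0))
    (herr : Tendsto (fun k => (C k).willieError ch) atTop (𝓝 0))
    (hrate : Tendsto (fun k => Real.log (M₂ k) / n k) atTop (𝓝 (mutualInfo Λ ch.willie))) :
    ∃ G : ∀ k, Finset (Fin (M₂ k)), Tendsto (fun k => ((G k).card : ℝ) / M₂ k) atTop (𝓝 1) ∧
      ∀ j : ∀ k, Fin (M₂ k), (∀ᶠ k in atTop, j k ∈ G k) → ReliableTypical ch (Λ 1) C j := by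
  obtain ⟨G, hG, r, hr, hGr⟩ := exists_large_small_sets hM
    (fun k j => ((C k).errBobCommon ch j + (C k).errBobCovert ch j)
      + |(C k).weightFraction j - Λ 1|)
    (fun k j => add_nonneg (add_nonneg ((C k).errBobCommon_nonneg j) ((C k).errBobCovert_nonneg j))
      (abs_nonneg _))
    (by
      have := hbob.add (tendsto_avg_abs_weight hch C hn hM herr hrate)
      simp only [Code.bobError, ← add_div, ← Finset.sum_add_distrib, add_zero] at this
      exact this)
  refine ⟨G, hG, fun j hj => ⟨?_, ?_, ?_⟩⟩
  · refine squeeze_zero' (Eventually.of_forall fun k => (C k).errBobCommon_nonneg _) ?_ hr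
    filter_upwards [hj] with k hk
    linarith [hGr k _ hk, (C k).errBobCovert_nonneg (ch := ch) (j k),
      abs_nonneg ((C k).weightFraction (j k) - Λ 1)]
  · refine squeeze_zero' (Eventually.of_forall fun k => (C k).errBobCovert_nonneg _) ?_ hr
    filter_upwards [hj] with k hk
    linarith [hGr k _ hk, (C k).errBobCommon_nonneg (ch := ch) (j k),
      abs_nonneg ((C k).weightFraction (j k) - Λ 1)]
  · rw [tendsto_iff_dist_tendsto_zero]
    refine squeeze_zero' (Eventually.of_forall fun k => dist_nonneg) ?_ hr
    filter_upwards [hj] with k hk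
    rw [Real.dist_eq]
    linarith [hGr k _ hk, (C k).errBobCommon_nonneg (ch := ch) (j k),
      (C k).errBobCovert_nonneg (ch := ch) (j k)]

end Typicality

/-! ### The optimal ratio -/

section Ratio

variable {a b c d : ℝ}

/-- Lagrange's identity: Cauchy-Schwarz for (a/√c, b/√d) and (√c, √d γ) with its defect written as a
square, which vanishes only at γ = bc/(ad). -/
theorem sq_ratio_eq (hc : 0 < c) (hd : 0 < d) (γ : ℝ) :
    (√2 * (a + b * γ) / √(c + d * γ ^ 2)) ^ 2
      = 2 * (a ^ 2 / c + b ^ 2 / d)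
        - 2 * (a * d * γ - b * c) ^ 2 / (c * d * (c + d * γ ^ 2)) := by
  have h : 0 < c + d * γ ^ 2 := by positivity
  rw [div_pow, mul_pow, Real.sq_sqrt h.le, Real.sq_sqrt (by norm_num)]
  field_simp
  ring

theorem ratio_le_ratio_opt (ha : 0 < a) (hb : 0 < b) (hc : 0 < c) (hd : 0 < d) (γ : ℝ) :
    √2 * (a + b * γ) / √(c + d * γ ^ 2)
      ≤ √2 * (a + b * (b * c / (a * d))) / √(c + d * (b * c / (a * d)) ^ 2) := by
  refine le_of_sq_le_sq ?_ (by positivity)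
  rw [sq_ratio_eq hc hd, sq_ratio_eq hc hd,
    show a * d * (b * c / (a * d)) - b * c = 0 by field_simp; ring]
  have : 0 ≤ 2 * (a * d * γ - b * c) ^ 2 / (c * d * (c + d * γ ^ 2)) := by positivity
  simpa using this

/-- Uniqueness of the maximizer, which turns an arbitrary maximizer into the explicit one. -/
theorem eq_opt_of_ratio_le (ha : 0 < a) (hb : 0 < b) (hc : 0 < c) (hd : 0 < d) {γ : ℝ}
    (h : √2 * (a + b * (b * c / (a * d))) / √(c + d * (b * c / (a * d)) ^ 2)
      ≤ √2 * (a + b * γ) / √(c + d * γ ^ 2)) : γ = b * c / (a * d) := by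
  have h1 := pow_le_pow_left₀ (by positivity) h 2
  rw [sq_ratio_eq hc hd, sq_ratio_eq hc hd,
    show a * d * (b * c / (a * d)) - b * c = 0 by field_simp; ring] at h1
  have h2 : 2 * (a * d * γ - b * c) ^ 2 / (c * d * (c + d * γ ^ 2)) ≤ 0 := by
    simpa using h1
  have h3 : 0 < c * d * (c + d * γ ^ 2) := by positivity
  rw [div_le_iff₀ h3, zero_mul] at h2
  have h4 : a * d * γ - b * c = 0 := by
    have : (a * d * γ - b * c) ^ 2 = 0 := le_antisymm (by linarith) (sq_nonneg _)
    simpa using this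
  field_simp
  linarith

end Ratio

/-! ### Asymptotics -/

section Asymptotics

/-- The quadratic form of the covertness constraint, centred at the optimal pair of normalized
flip masses, in terms of the linear functional of the reliability constraint. -/
theorem quadratic_centred {lam D0 D1 c0 c1 γ : ℝ} (h0 : 0 < lam) (h1 : lam < 1) (hD0 : 0 < D0)
    (hD1 : 0 < D1) (hc0 : 0 < c0) (hc1 : 0 < c1) (hγ : γ = D1 * c0 / (D0 * c1)) (u v : ℝ) :
    c0 / (1 - lam) * (u - √2 * (1 - lam) / √((1 - lam) * c0 + lam * γ ^ 2 * c1)) ^ 2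
      + c1 / lam * (v - √2 * (lam * γ) / √((1 - lam) * c0 + lam * γ ^ 2 * c1)) ^ 2
      = c0 / (1 - lam) * u ^ 2 + c1 / lam * v ^ 2 + 2 - 4 * (D0 * u + D1 * v) /
        (√2 * ((1 - lam) * D0 + lam * γ * D1) / √((1 - lam) * c0 + lam * γ ^ 2 * c1)) := by
  have hl : 0 < 1 - lam := by linarith
  have hγ0 : 0 < γ := by rw [hγ]; positivity
  have hs : (√2 : ℝ) ^ 2 = 2 := Real.sq_sqrt (by norm_num)
  have hs0 : 0 < (√2 : ℝ) := by positivity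
  have hr0 : 0 < √((1 - lam) * c0 + lam * γ ^ 2 * c1) := by positivity
  have hr : √((1 - lam) * c0 + lam * γ ^ 2 * c1) ^ 2 = (1 - lam) * c0 + lam * γ ^ 2 * c1 :=
    Real.sq_sqrt (by positivity)
  set r := √((1 - lam) * c0 + lam * γ ^ 2 * c1)
  -- The optimality condition: the linear functional (D0, D1) is parallel to the gradient of the
  -- quadratic form at the centre.
  have hD1' : D1 = γ * D0 * c1 / c0 := by rw [hγ]; field_simp
  have hf : √2 * ((1 - lam) * D0 + lam * γ * D1) / r = √2 * r * D0 / c0 := by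
    have : (1 - lam) * D0 + lam * γ * D1 = r ^ 2 * D0 / c0 := by
      rw [hr, hD1']; field_simp
    rw [this]; field_simp
  -- The centre lies on the boundary of the ellipse, where the form equals 2.
  have hn : c0 / (1 - lam) * (√2 * (1 - lam) / r) ^ 2 + c1 / lam * (√2 * (lam * γ) / r) ^ 2 = 2 := by
    have : c0 / (1 - lam) * (√2 * (1 - lam) / r) ^ 2 + c1 / lam * (√2 * (lam * γ) / r) ^ 2
        = √2 ^ 2 * ((1 - lam) * c0 + lam * γ ^ 2 * c1) / r ^ 2 := by
      field_simp
    rw [this, hr, hs]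
    field_simp
  have hx : 2 * (c0 / (1 - lam) * u * (√2 * (1 - lam) / r) + c1 / lam * v * (√2 * (lam * γ) / r))
      = 4 * (D0 * u + D1 * v) / (√2 * r * D0 / c0) := by
    rw [hD1']
    have : (4 : ℝ) = 2 * √2 ^ 2 := by rw [hs]; norm_num
    rw [this]
    field_simp
  rw [hf, ← hx]
  linear_combination hn

/-- The asymptotic trade-off between the number of covert nats `L`, the flip masses `A0`, `A1` and
the divergence `δ`. -/
theorem asymptotic_tradeoff {lam D0 D1 E0 E1 c0 c1 γ K : ℝ} (h0 : 0 < lam) (h1 : lam < 1)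
    (hD0 : 0 < D0) (hD1 : 0 < D1) (hc0 : 0 < c0) (hc1 : 0 < c1)
    (hγ : γ = D1 * c0 / (D0 * c1)) {n δ L A0 A1 w e η S0 S1 : ℕ → ℝ}
    (hn : Tendsto n atTop atTop) (hδ : Tendsto δ atTop (𝓝 0)) (hw : Tendsto w atTop (𝓝 lam))
    (he : Tendsto e atTop (𝓝 0)) (hη : Tendsto η atTop (𝓝 0)) (hη0 : ∀ k, 0 < η k)
    (hL : ∀ k, 0 ≤ L k) (hδ0 : ∀ k, 0 ≤ δ k) (hS0 : ∀ k, 0 ≤ S0 k) (hS1 : ∀ k, 0 ≤ S1 k)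
    (hrel : ∀ k, η k ≤ 1 → (1 - e k) * (L k + Real.log (η k)⁻¹) - 1 ≤ A0 k * D0 + A1 k * D1)
    (hA0 : ∀ k, A0 k ^ 2 ≤ (n k - n k * w k) * S0 k) (hA1 : ∀ k, A1 k ^ 2 ≤ n k * w k * S1 k)
    (hcov : ∀ k, c0 * S0 k + c1 * S1 k ≤ (2 + K * √(δ k)) * δ k)
    (hres : ∀ k, A0 k * E0 + A1 k * E1 ≤ L k + δ k) :
    (∀ᶠ k in atTop, 0 < δ k) ∧
    limsup (fun k => ((L k / √(n k * δ k) : ℝ) : EReal)) atTop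
      ≤ ((√2 * ((1 - lam) * D0 + lam * γ * D1) / √((1 - lam) * c0 + lam * γ ^ 2 * c1) : ℝ)
        : EReal) ∧
    (Tendsto (fun k => L k / √(n k * δ k)) atTop
        (𝓝 (√2 * ((1 - lam) * D0 + lam * γ * D1) / √((1 - lam) * c0 + lam * γ ^ 2 * c1))) →
      √2 * ((1 - lam) * E0 + lam * γ * E1) / √((1 - lam) * c0 + lam * γ ^ 2 * c1)
        ≤ √2 * ((1 - lam) * D0 + lam * γ * D1) / √((1 - lam) * c0 + lam * γ ^ 2 * c1)) := by
  have hl : 0 < 1 - lam := by linarith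
  have hγ0 : 0 < γ := by rw [hγ]; positivity
  have hquad := quadratic_centred h0 h1 hD0 hD1 hc0 hc1 hγ
  have hr0 : 0 < √((1 - lam) * c0 + lam * γ ^ 2 * c1) := by positivity
  set r := √((1 - lam) * c0 + lam * γ ^ 2 * c1)
  have hf0 : 0 < √2 * ((1 - lam) * D0 + lam * γ * D1) / r := by positivity
  set f := √2 * ((1 - lam) * D0 + lam * γ * D1) / r
  have h1e : Tendsto (fun k => 1 - e k) atTop (𝓝 1) := by
    simpa using tendsto_const_nhds.sub he
  have hlog : Tendsto (fun k => (1 - e k) * Real.log (η k)⁻¹) atTop atTop := by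
    refine h1e.pos_mul_atTop one_pos (Real.tendsto_log_atTop.comp ?_)
    exact tendsto_inv_nhdsGT_zero.comp
      (tendsto_nhdsWithin_iff.2 ⟨hη, Eventually.of_forall hη0⟩)
  have he_pos : ∀ᶠ k in atTop, 0 < 1 - e k := h1e.eventually (lt_mem_nhds one_pos)
  -- The divergence of log η⁻¹ absorbs the -1 and leaves a positive slack, which forces nonzero flip
  -- masses and hence δ > 0.
  have hT : ∀ᶠ k in atTop, (1 - e k) * L k + 1 ≤ A0 k * D0 + A1 k * D1 := by
    filter_upwards [hlog.eventually_ge_atTop 2, hη.eventually (gt_mem_nhds one_pos)] with k hk hk'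
    have := hrel k hk'.le
    linarith
  have hpos : ∀ᶠ k in atTop, 0 < δ k := by
    filter_upwards [hT, he_pos] with k hk hke
    refine (hδ0 k).lt_of_ne fun h => ?_
    have hc := hcov k
    rw [← h, mul_zero] at hc
    have hs0 : S0 k = 0 := by
      nlinarith [hS0 k, hS1 k, mul_nonneg hc0.le (hS0 k), mul_nonneg hc1.le (hS1 k)]
    have hs1 : S1 k = 0 := by
      nlinarith [hS0 k, hS1 k, mul_nonneg hc0.le (hS0 k), mul_nonneg hc1.le (hS1 k)]
    have ha0 : A0 k = 0 := by
      have := hA0 k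
      rw [hs0, mul_zero] at this
      exact pow_eq_zero_iff two_ne_zero |>.1 (le_antisymm this (sq_nonneg _))
    have ha1 : A1 k = 0 := by
      have := hA1 k
      rw [hs1, mul_zero] at this
      exact pow_eq_zero_iff two_ne_zero |>.1 (le_antisymm this (sq_nonneg _))
    rw [ha0, ha1] at hk
    linarith [mul_nonneg hke.le (hL k)]
  set s : ℕ → ℝ := fun k => √(n k * δ k) with hs
  set u : ℕ → ℝ := fun k => A0 k / s k with hu
  set v : ℕ → ℝ := fun k => A1 k / s k with hv
  -- One factor tending to 1 that replaces the actual weights of zeros and ones by 1 - lam and lam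
  -- simultaneously.
  set τ : ℕ → ℝ := fun k => max ((1 - w k) / (1 - lam)) (w k / lam) with hτ
  set ε : ℕ → ℝ := fun k => τ k * (2 + K * √(δ k)) - 2 with hε
  have hτ1 : Tendsto τ atTop (𝓝 1) := by
    have ha : Tendsto (fun k => (1 - w k) / (1 - lam)) atTop (𝓝 1) := by
      have := (tendsto_const_nhds (x := (1 : ℝ)).sub hw).div_const (1 - lam)
      rwa [div_self hl.ne'] at this
    have hb : Tendsto (fun k => w k / lam) atTop (𝓝 1) := by
      have := hw.div_const lam
      rwa [div_self h0.ne'] at this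
    simpa using ha.max hb
  have hε0 : Tendsto ε atTop (𝓝 0) := by
    have hsq : Tendsto (fun k => √(δ k)) atTop (𝓝 0) := by simpa using hδ.sqrt
    have := (hτ1.mul ((hsq.const_mul K).const_add 2)).sub_const 2
    simpa using this
  have hspos : ∀ᶠ k in atTop, 0 < s k := by
    filter_upwards [hpos, hn.eventually_gt_atTop 0] with k hk hnk
    exact Real.sqrt_pos.2 (mul_pos hnk hk)
  have hN : ∀ᶠ k in atTop, c0 / (1 - lam) * u k ^ 2 + c1 / lam * v k ^ 2 ≤ 2 + ε k := by
    filter_upwards [hpos, hspos, hn.eventually_gt_atTop 0, hτ1.eventually (lt_mem_nhds one_pos)]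
      with k hk hsk hnk hτk
    have hs2 : s k ^ 2 = n k * δ k := Real.sq_sqrt (mul_pos hnk hk).le
    have hi0 : c0 / (1 - lam) * A0 k ^ 2 ≤ n k * τ k * (c0 * S0 k) := by
      have ht : 1 - w k ≤ τ k * (1 - lam) := (div_le_iff₀ hl).1 (le_max_left _ _)
      have := (hA0 k).trans (show (n k - n k * w k) * S0 k ≤ n k * (τ k * (1 - lam)) * S0 k from
        mul_le_mul_of_nonneg_right (by nlinarith) (hS0 k))
      calc c0 / (1 - lam) * A0 k ^ 2 ≤ c0 / (1 - lam) * (n k * (τ k * (1 - lam)) * S0 k) :=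
            mul_le_mul_of_nonneg_left this (by positivity)
        _ = _ := by field_simp
    have hi1 : c1 / lam * A1 k ^ 2 ≤ n k * τ k * (c1 * S1 k) := by
      have ht : w k ≤ τ k * lam := (div_le_iff₀ h0).1 (le_max_right _ _)
      have := (hA1 k).trans (show n k * w k * S1 k ≤ n k * (τ k * lam) * S1 k from
        mul_le_mul_of_nonneg_right (mul_le_mul_of_nonneg_left ht hnk.le) (hS1 k))
      calc c1 / lam * A1 k ^ 2 ≤ c1 / lam * (n k * (τ k * lam) * S1 k) :=
            mul_le_mul_of_nonneg_left this (by positivity)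
        _ = _ := by field_simp
    have hi2 := mul_le_mul_of_nonneg_left (hcov k) (mul_pos hnk hτk).le
    have hgoal : c0 / (1 - lam) * u k ^ 2 + c1 / lam * v k ^ 2
        = (c0 / (1 - lam) * A0 k ^ 2 + c1 / lam * A1 k ^ 2) / s k ^ 2 := by
      simp only [hu, hv]
      ring
    rw [hgoal, div_le_iff₀ (by positivity), hs2]
    simp only [hε]
    linarith
  have hX : ∀ᶠ k in atTop, (1 - e k) * (L k / s k) ≤ D0 * u k + D1 * v k := by
    filter_upwards [hT, hspos] with k hk hsk
    have : D0 * u k + D1 * v k = (A0 k * D0 + A1 k * D1) / s k := by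
      simp only [hu, hv]; ring
    rw [this, ← mul_div_assoc]
    exact div_le_div_of_nonneg_right (by linarith) hsk.le
  -- The distance to the optimal pair is bounded by the throughput shortfall. Nonnegativity of the
  -- left side gives the upper bound; a vanishing right side gives convergence of u and v.
  have hdiff : ∀ᶠ k in atTop, c0 / (1 - lam) * (u k - √2 * (1 - lam) / r) ^ 2
      + c1 / lam * (v k - √2 * (lam * γ) / r) ^ 2
      ≤ 4 + ε k - 4 * ((1 - e k) * (L k / s k)) / f := by
    filter_upwards [hN, hX] with k hk hk'
    rw [hquad]
    have : 4 * ((1 - e k) * (L k / s k)) / f ≤ 4 * (D0 * u k + D1 * v k) / f :=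
      div_le_div_of_nonneg_right (by linarith) hf0.le
    linarith
  refine ⟨hpos, ?_, fun ht => ?_⟩
  · set bd : ℕ → ℝ := fun k => f * (1 + ε k / 4) / (1 - e k) with hbd
    have hbdt : Tendsto bd atTop (𝓝 f) := by
      have := (((hε0.div_const 4).const_add 1).const_mul f).div h1e one_ne_zero
      rwa [zero_div, add_zero, mul_one, div_one] at this
    have hle : ∀ᶠ k in atTop, L k / s k ≤ bd k := by
      filter_upwards [hdiff, he_pos] with k hk hke
      have hnn : 0 ≤ c0 / (1 - lam) * (u k - √2 * (1 - lam) / r) ^ 2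
          + c1 / lam * (v k - √2 * (lam * γ) / r) ^ 2 := by positivity
      have h4 : 4 * ((1 - e k) * (L k / s k)) / f ≤ 4 + ε k := by linarith
      rw [div_le_iff₀ hf0] at h4
      simp only [hbd]
      rw [le_div_iff₀ hke]
      linarith
    refine (limsup_le_limsup (v := fun k => ((bd k : ℝ) : EReal)) ?_).trans ?_
    · filter_upwards [hle] with k hk
      exact EReal.coe_le_coe_iff.2 hk
    · exact ((continuous_coe_real_ereal.tendsto f).comp hbdt).limsup_eq.le
  · have hd0 : Tendsto (fun k => 4 + ε k - 4 * ((1 - e k) * (L k / s k)) / f) atTop (𝓝 0) := by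
      have := ((hε0.const_add 4)).sub ((((h1e.mul ht)).const_mul 4).div_const f)
      rwa [one_mul, add_zero, mul_div_cancel_right₀ _ hf0.ne', sub_self] at this
    have hconv : ∀ (c t : ℝ) (x : ℕ → ℝ), 0 < c → (∀ᶠ k in atTop, c * (x k - t) ^ 2
        ≤ 4 + ε k - 4 * ((1 - e k) * (L k / s k)) / f) → Tendsto x atTop (𝓝 t) := by
      intro c t x hc hx
      have h2 : Tendsto (fun k => (4 + ε k - 4 * ((1 - e k) * (L k / s k)) / f) / c) atTop (𝓝 0) := by
        simpa using hd0.div_const c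
      have h3 : Tendsto (fun k => (x k - t) ^ 2) atTop (𝓝 0) := by
        refine squeeze_zero' (Eventually.of_forall fun k => sq_nonneg _) ?_ h2
        filter_upwards [hx] with k hk
        rw [le_div_iff₀ hc]
        linarith
      have h4 : Tendsto (fun k => |x k - t|) atTop (𝓝 0) := by
        simpa [Real.sqrt_sq_eq_abs] using h3.sqrt
      rw [tendsto_iff_dist_tendsto_zero]
      simpa [Real.dist_eq] using h4
    have hul : Tendsto u atTop (𝓝 (√2 * (1 - lam) / r)) := by
      refine hconv (c0 / (1 - lam)) _ u (by positivity) ?_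
      filter_upwards [hdiff] with k hk
      have : 0 ≤ c1 / lam * (v k - √2 * (lam * γ) / r) ^ 2 := by positivity
      linarith
    have hvl : Tendsto v atTop (𝓝 (√2 * (lam * γ) / r)) := by
      refine hconv (c1 / lam) _ v (by positivity) ?_
      filter_upwards [hdiff] with k hk
      have : 0 ≤ c0 / (1 - lam) * (u k - √2 * (1 - lam) / r) ^ 2 := by positivity
      linarith
    have hlim := (hul.const_mul E0).add (hvl.const_mul E1)
    have hlim2 : Tendsto (fun k => L k / s k + √(δ k)) atTop (𝓝 (f + 0)) :=
      ht.add (by simpa using hδ.sqrt)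
    have hfin := le_of_tendsto_of_tendsto hlim hlim2 ?_
    · refine le_trans (le_of_eq ?_) (hfin.trans (le_of_eq (add_zero f)))
      ring
    · filter_upwards [hspos, hpos, hn.eventually_ge_atTop 1] with k hsk hk hnk
      have e1 : E0 * u k + E1 * v k = (A0 k * E0 + A1 k * E1) / s k := by
        simp only [hu, hv]; ring
      rw [e1, div_le_iff₀ hsk, add_mul, div_mul_cancel₀ _ hsk.ne']
      refine (hres k).trans (add_le_add_right ?_ _)
      -- Since n ≥ 1, the resolvability error δ/s is at most √δ and vanishes.
      have h5 : √(δ k) ≤ s k := Real.sqrt_le_sqrt (by nlinarith)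
      calc δ k = √(δ k) * √(δ k) := (Real.mul_self_sqrt hk.le).symm
        _ ≤ √(δ k) * s k := mul_le_mul_of_nonneg_left h5 (Real.sqrt_nonneg _)

end Asymptotics

/-! ### Assembly of the converse -/

theorem bob_ne {Y Z : Type*} [Fintype Y] [Fintype Z] {ch : BroadcastChannel Y Z}
    {Λ : Fin 2 → ℝ} (hch : ch.Standing Λ) : ch.bob 0 ≠ ch.bob 1 := by
  intro h
  -- Bob's information under Λ is at least Willie's positive capacity, whereas equal rows would make
  -- it zero.
  have hI := (mutualInfo_pos_of_unique hch.capacity hch.capacity_unique hch.pos).trans_le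
    hch.bob_ge
  have hout : outLaw ch.bob Λ = ch.bob 1 := by
    ext b
    simp only [outLaw, Fin.sum_univ_two, h, zero_apply_eq hch.capacity.1]
    ring
  rw [mutualInfo_eq, hout, h, kl_self] at hI
  simp at hI

end CovertBroadcast

open CovertBroadcast in
theorem theorem2 {Y Z : Type*} [Fintype Y] [Fintype Z]
    (ch : BroadcastChannel Y Z) (Λ : Fin 2 → ℝ) (hch : ch.Standing Λ) :
    -- the maximum over `γ ≥ 0` is attained
    (∃ γs : ℝ, 0 ≤ γs ∧ IsMaxOn (ratio ch ch.bob (Λ 1)) (Set.Ici 0) γs) ∧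
    ∀ γs : ℝ, 0 ≤ γs → IsMaxOn (ratio ch ch.bob (Λ 1)) (Set.Ici 0) γs →
    ∀ (n M₁ M₂ : ℕ → ℕ) (C : ∀ k, Code Y Z (n k) (M₁ k) (M₂ k)),
      StrictMono n → (∀ k, 0 < M₁ k) → (∀ k, 0 < M₂ k) →
      Tendsto (fun k => (C k).bobError ch) atTop (𝓝 0) →
      Tendsto (fun k => (C k).willieError ch) atTop (𝓝 0) →
      (∀ j : ∀ k, Fin (M₂ k), Tendsto (fun k => (C k).divergence ch (j k)) atTop (𝓝 0)) →
      Tendsto (fun k => Real.log (M₂ k) / n k) atTop (𝓝 (mutualInfo Λ ch.willie)) →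
      -- all but a vanishing fraction of the common messages are reliable and typical
      (∃ G : ∀ k, Finset (Fin (M₂ k)),
        Tendsto (fun k => ((G k).card : ℝ) / M₂ k) atTop (𝓝 1) ∧
        ∀ j : ∀ k, Fin (M₂ k), (∀ᶠ k in atTop, j k ∈ G k) →
          ReliableTypical ch (Λ 1) C j) ∧
      -- and for every such choice of common messages both bounds hold
      ∀ j : ∀ k, Fin (M₂ k), ReliableTypical ch (Λ 1) C j →
        (∀ᶠ k in atTop, 0 < (C k).divergence ch (j k)) ∧
        limsup (fun k => (((C k).throughput ch (j k) : ℝ) : EReal)) atTop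
          ≤ ((ratio ch ch.bob (Λ 1) γs : ℝ) : EReal) ∧
        (Tendsto (fun k => (C k).throughput ch (j k)) atTop (𝓝 (ratio ch ch.bob (Λ 1) γs)) →
          ((ratio ch ch.willie (Λ 1) γs : ℝ) : EReal)
            ≤ liminf (fun k => (((C k).throughput ch (j k) : ℝ) : EReal)) atTop) := by
  have hlam0 := hch.pos
  have hlam1 := lt_one_of_unique hch.capacity hch.capacity_unique hch.pos
  have hl : 0 < 1 - Λ 1 := by linarith
  have hbob := bob_mem_stdSimplex ch
  have hwil := willie_mem_stdSimplex ch
  have hD0 : 0 < kl (ch.bob 1) (ch.bob 0) :=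
    kl_pos (hbob 1) (hbob 0) (bob_absCont hch 1 0) (bob_ne hch).symm
  have hD1 : 0 < kl (ch.bob 0) (ch.bob 1) :=
    kl_pos (hbob 0) (hbob 1) (bob_absCont hch 0 1) (bob_ne hch)
  have hc0 : 0 < chiSq (ch.willie 1) (ch.willie 0) :=
    chiSq_pos (hwil 0) (willie_absCont hch 1 0) hch.willie_ne.symm
  have hc1 : 0 < chiSq (ch.willie 0) (ch.willie 1) :=
    chiSq_pos (hwil 1) (willie_absCont hch 0 1) hch.willie_ne
  set D0 := kl (ch.bob 1) (ch.bob 0)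
  set D1 := kl (ch.bob 0) (ch.bob 1)
  set c0 := chiSq (ch.willie 1) (ch.willie 0)
  set c1 := chiSq (ch.willie 0) (ch.willie 1)
  have hratio : ∀ γ, ratio ch ch.bob (Λ 1) γ = √2 * ((1 - Λ 1) * D0 + Λ 1 * D1 * γ)
      / √((1 - Λ 1) * c0 + Λ 1 * c1 * γ ^ 2) := by
    intro γ
    rw [ratio, mul_right_comm (Λ 1) γ, mul_right_comm (Λ 1) (γ ^ 2)]
  have hopt := ratio_le_ratio_opt (mul_pos hl hD0) (mul_pos hlam0 hD1) (mul_pos hl hc0)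
    (mul_pos hlam0 hc1)
  refine ⟨⟨Λ 1 * D1 * ((1 - Λ 1) * c0) / ((1 - Λ 1) * D0 * (Λ 1 * c1)), by positivity,
    isMaxOn_iff.2 fun γ _ => ?_⟩, ?_⟩
  · simp only [hratio]
    exact hopt γ
  intro γs hγs hmax n M₁ M₂ C hn hM₁ hM₂ hPb hPw hdiv hrate
  have hγ : γs = D1 * c0 / (D0 * c1) := by
    have h := isMaxOn_iff.1 hmax _ (show Λ 1 * D1 * ((1 - Λ 1) * c0) / ((1 - Λ 1) * D0 * (Λ 1 * c1)) ∈ Set.Ici 0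
      from by simp only [Set.mem_Ici]; positivity)
    simp only [hratio] at h
    rw [eq_opt_of_ratio_le (mul_pos hl hD0) (mul_pos hlam0 hD1) (mul_pos hl hc0)
      (mul_pos hlam0 hc1) h]
    field_simp
  refine ⟨exists_reliableTypical hch C hn.tendsto_atTop hM₂ hPb hPw hrate, ?_⟩
  rintro j ⟨hcommon, hcovert, hweight⟩
  obtain ⟨K, -, hK⟩ := exists_mass_sq_le hch
  have hKk := fun k => hK _ _ _ (C k) (j k) (hM₁ k)
  choose hδ0 S₀ S₁ hS₀ hS₁ hA₀ hA₁ hcov using hKk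
  -- The covert error may be exactly zero; the added 1/(k+1) keeps log η⁻¹ meaningful and divergent.
  have hη0 : ∀ k, 0 < (C k).errBobCovert ch (j k) + 1 / ((k : ℝ) + 1) := fun k =>
    add_pos_of_nonneg_of_pos ((C k).errBobCovert_nonneg _) (by positivity)
  have hη : Tendsto (fun k => (C k).errBobCovert ch (j k) + 1 / ((k : ℝ) + 1)) atTop (𝓝 0) := by
    simpa using hcovert.add tendsto_one_div_add_atTop_nhds_zero_nat
  obtain ⟨h1, h2, h3⟩ := asymptotic_tradeoff (n := fun k => (n k : ℝ))
    (L := fun k => Real.log (M₁ k)) (A0 := fun k => (C k).mass (j k) 0)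
    (A1 := fun k => (C k).mass (j k) 1) (w := fun k => (C k).weightFraction (j k))
    (δ := fun k => (C k).divergence ch (j k))
    (e := fun k => (C k).errBobCommon ch (j k) + (C k).errBobCovert ch (j k))
    (η := fun k => (C k).errBobCovert ch (j k) + 1 / ((k : ℝ) + 1)) (S0 := S₀) (S1 := S₁)
    (E0 := kl (ch.willie 1) (ch.willie 0)) (E1 := kl (ch.willie 0) (ch.willie 1))
    hlam0 hlam1 hD0 hD1 hc0 hc1 hγ (tendsto_natCast_atTop_atTop.comp hn.tendsto_atTop) (hdiv j)
    hweight (by simpa using hcommon.add hcovert) hη hη0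
    (fun k => Real.log_nonneg (by exact_mod_cast hM₁ k)) hδ0 hS₀ hS₁
    (fun k hk => by
      have := (C k).log_le_mass_bob hch (hM₁ k) (j k) (hη0 k) hk
        (le_add_of_nonneg_right (by positivity))
      rwa [sub_sub] at this)
    hA₀ hA₁ hcov (fun k => (C k).mass_willie_le hch (hM₁ k) (j k))
  refine ⟨h1, h2, fun ht => ?_⟩
  -- Under equality the throughput converges, so its liminf is Bob's optimal ratio and only a
  -- comparison of two numbers remains.
  have hlim := ((continuous_coe_real_ereal.tendsto _).comp ht).liminf_eq
  refine le_trans (EReal.coe_le_coe_iff.2 (h3 ht)) (le_of_eq ?_)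
  exact hlim.symm
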